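/- For a locally finite set $\Lambda\subset\mathbb R^2$ and $m\in\mathbb R$, let $\mathscr F_\Lambda$ (depending on $m$) be the set of vector fields $j\in L^2_{\rm loc}(\mathbb R^2\setminus\Lambda,\mathbb R^2)\cap L^1_{\rm loc}(\mathbb R^2,\mathbb R^2)$ such that $$-\operatorname{div} j = 2\pi\Big(\sum_{p\in\Lambda}\delta_p-m\Big)\quad\text{in the sense of distributions on }\mathbb R^2.$$ Let $B_R$ be the ball of radius $R$ centered at $0$, and let $(\chi_R)_{R>1}$ be a family of smooth cutoff functions with $\chi_R\ge 0$, $\chi_R= 1$ on $B_{R-1}$, $\chi_R= 0$ on $\mathbb R^2\setminus B_R$ and $\|\nabla\chi_R\|_\infty\le C_0$, where $C_0$ does not depend on $R$. Put $$W(j,\chi_R)=\limsup_{\eta\to0^+}\Big(\frac12\int_{\mathbb R^2\setminus\bigcup_{p\in\Lambda}B(p,\eta)}\chi_R|j|^2+\pi\log\eta\sum_{p\in\Lambda}\chi_R(p)\Big),\qquad W(j)=\limsup_{R\to\infty}\frac{W(j,\chi_R)}{|B_R|},$$ and $\tilde W(\Lambda)=\inf_{j\in\mathscr F_\Lambda}W(j)\in[-\infty,+\infty]$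 (with $\inf\emptyset=+\infty$). **Theorem 3.** Let $A\subset\mathbb Z^2$ and $\Lambda=\mathbb Z^2\setminus A$. Assume there exists a constant $C>0$ such that for all $x\in\mathbb R^2$ and all $R>1$ $$\#\big(A\cap B(x,R)\big)\le CR.$$ Then, with the background density $m=1$ and for every such family of cutoff functions, $\tilde W(\Lambda)<+\infty$. -/

import Mathlib

open MeasureTheory Filter Topology Set

noncomputable section

/-- The Euclidean plane. -/
abbrev Plane : Type := EuclideanSpace ℝ (Fin 2)

/-- The square lattice `ℤ²`, as a subset of the plane. -/
def intLattice : Set Plane := {x | ∀ i, ∃ n : ℤ, x i = (n : ℝ)}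

/-- `-div j = 2π (∑_{p ∈ Λ} δ_p - m)` in the sense of distributions on the whole plane:
`j` is locally integrable and, for every test function `φ`,
`∫ j · ∇φ = 2π (∑_{p ∈ Λ} φ(p) - m ∫ φ)`.  (Here `fderiv ℝ φ x (j x) = ∇φ(x) · j(x)`; the sum
has finitely many nonzero terms since `Λ` is locally finite.) -/
def SolvesDivEq (Λ : Set Plane) (m : ℝ) (j : Plane → Plane) : Prop :=
  LocallyIntegrable j volume ∧
    ∀ φ : Plane → ℝ, ContDiff ℝ (⊤ : ℕ∞) φ → HasCompactSupport φ →
      ∫ x, fderiv ℝ φ x (j x) =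
        2 * Real.pi * ((∑ᶠ p ∈ Λ, φ p) - m * ∫ x, φ x)

/-- `j ∈ L²_loc(ℝ² ∖ Λ, ℝ²)`: square integrable on every compact subset of `ℝ² ∖ Λ`. -/
def MemL2LocOff (Λ : Set Plane) (j : Plane → Plane) : Prop :=
  ∀ K : Set Plane, IsCompact K → K ⊆ Λᶜ → MemLp j 2 (volume.restrict K)

/-- The class of admissible vector fields for the point set `Λ` and the background `m`. -/
def admissibleFields (Λ : Set Plane) (m : ℝ) : Set (Plane → Plane) :=
  {j | MemL2LocOff Λ j ∧ SolvesDivEq Λ m j}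

/-- A family `(χ_R)_{R > 1}` of smooth cutoff functions: `χ_R ≥ 0`, `|∇χ_R| ≤ C` with `C`
independent of `R`, `χ_R = 1` on `B_{R-1}` and `χ_R = 0` outside `B_R`. -/
def IsCutoffFamily (χ : ℝ → Plane → ℝ) : Prop :=
  ∃ C : ℝ, ∀ R : ℝ, 1 < R →
    ContDiff ℝ (⊤ : ℕ∞) (χ R) ∧
    (∀ x, 0 ≤ χ R x) ∧
    (∀ x, ‖fderiv ℝ (χ R) x‖ ≤ C) ∧
    (∀ x ∈ Metric.ball (0 : Plane) (R - 1), χ R x = 1) ∧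
    (∀ x ∉ Metric.ball (0 : Plane) R, χ R x = 0)

/-- `W(j, χ) = limsup_{η → 0⁺} (½ ∫_{ℝ² ∖ ⋃_{p ∈ Λ} B(p, η)} χ |j|² + π log η ∑_{p ∈ Λ} χ(p))`. -/
def cutoffEnergy (Λ : Set Plane) (j : Plane → Plane) (χ : Plane → ℝ) : EReal :=
  limsup (fun η : ℝ =>
    (((∫⁻ x in (⋃ p ∈ Λ, Metric.ball p η)ᶜ, ENNReal.ofReal (χ x * ‖j x‖ ^ 2)) / 2 : ENNReal) :
        EReal) +
      ((Real.pi * Real.log η * ∑ᶠ p ∈ Λ, χ p : ℝ) : EReal)) (𝓝[>] (0 : ℝ))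

/-- `W(j) = limsup_{R → ∞} W(j, χ_R) / |B_R|`, where `|B_R| = π R²`. -/
def energy (χ : ℝ → Plane → ℝ) (Λ : Set Plane) (j : Plane → Plane) : EReal :=
  limsup (fun R : ℝ => cutoffEnergy Λ j (χ R) / ((Real.pi * R ^ 2 : ℝ) : EReal)) atTop

/-- The renormalized energy `W̃(Λ) = inf W(j)` over all admissible (not necessarily curl-free)
fields `j` for the background `m`; it is `+∞` if there is no such field. -/
def renormalizedEnergy (χ : ℝ → Plane → ℝ) (m : ℝ) (Λ : Set Plane) : EReal :=
  ⨅ j ∈ admissibleFields Λ m, energy χ Λ j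

end

noncomputable section

/-! The infimum is bounded by the energy of one explicit competitor, `totalField`, which need not be
curl-free. At each occupied lattice point it places `cellField`: the charge is neutralised by the
background of its own unit cell, with no flux through the boundary, so these cells do not interact.
At a vacancy (a point of `A`) the background of the cell has no charge to balance it, and `jetField`
carries its mass to infinity inside a horizontal cone; the jet is bounded and decays like the
inverse distance. Jets point away from the axis `x₀ = 0`, so only finitely many of them meet a
bounded set, and the sum solves the equation (`totalField_mem_admissibleFields`).

In the cell of `p` the competitor is at most `1 / ‖x - p‖` (only if `p` is occupied), plus a
constant, plus a multiple of `potential`, the sum of inverse distances to the vacancies nearby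
(`norm_totalField_le`). After squaring and weighting by the cutoff, the singular part yields exactly
the logarithm that the renormalisation removes; the rest is of order one plus the squared potential
(`lintegral_latCell_le`).

It remains to bound the sum of squared potentials over a box of size `R` by a multiple of `R²`
(`sum_potential_sq_le`). Splitting `d⁻²` as `d^(-1/2) * d^(-3/2)`, Cauchy–Schwarz bounds each
squared potential by a product of two sums over vacancies. The first is of order `√R` because
vacancies have linear counting. The second, summed over all `p`, costs `√R` per vacancy by planar
counting, and there are at most of order `R` vacancies. The product is of order `R²`, the area. -/

/-! ### Cartesian coordinates on the plane -/

/-- The point of the plane with given Cartesian coordinates. -/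
def planeMk (z : ℝ × ℝ) : Plane := !₂[z.1, z.2]

@[simp] lemma planeMk_zero (z : ℝ × ℝ) : planeMk z 0 = z.1 := by simp [planeMk]
@[simp] lemma planeMk_one (z : ℝ × ℝ) : planeMk z 1 = z.2 := by simp [planeMk]

lemma planeMk_injective : Function.Injective planeMk := by
  intro z w h
  have h0 := congrArg (fun x : Plane => x 0) h
  have h1 := congrArg (fun x : Plane => x 1) h
  simp only [planeMk_zero, planeMk_one] at h0 h1
  exact Prod.ext h0 h1

/-- `planeMk` as a continuous linear map. -/
def planeMkL : ℝ × ℝ →L[ℝ] Plane :=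
  LinearMap.toContinuousLinearMap
    { toFun := planeMk
      map_add' := fun z w => by ext i; fin_cases i <;> simp
      map_smul' := fun c z => by ext i; fin_cases i <;> simp }

@[simp] lemma planeMkL_apply (z : ℝ × ℝ) : planeMkL z = planeMk z := rfl

@[fun_prop] lemma continuous_planeMk : Continuous planeMk := planeMkL.continuous

lemma contDiff_planeMk {n : WithTop ℕ∞} : ContDiff ℝ n planeMk := planeMkL.contDiff

lemma planeMk_eq : planeMk = (MeasurableEquiv.finTwoArrow.symm.trans
    (MeasurableEquiv.toLp 2 (Fin 2 → ℝ)) : ℝ × ℝ ≃ᵐ Plane) := by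
  funext z
  ext i; fin_cases i <;> simp [planeMk, MeasurableEquiv.finTwoArrow]

lemma measurableEmbedding_planeMk : MeasurableEmbedding planeMk := by
  rw [planeMk_eq]; exact MeasurableEquiv.measurableEmbedding _

lemma measurePreserving_planeMk : MeasurePreserving planeMk := by
  rw [planeMk_eq]
  exact (volume_preserving_finTwoArrow ℝ).symm.trans
    (EuclideanSpace.volume_preserving_symm_measurableEquiv_toLp (Fin 2)).symm

lemma norm_planeMk_sq (x : Plane) : ‖x‖ ^ 2 = x 0 ^ 2 + x 1 ^ 2 := by
  rw [EuclideanSpace.norm_sq_eq]; simp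

lemma abs_coord_le_norm (x : Plane) (i : Fin 2) : |x i| ≤ ‖x‖ := by
  simpa using PiLp.norm_apply_le x i

lemma norm_le_abs_add_abs (x : Plane) : ‖x‖ ≤ |x 0| + |x 1| := by
  refine abs_le_of_sq_le_sq' ?_ (by positivity) |>.2
  rw [norm_planeMk_sq]
  nlinarith [sq_abs (x 0), sq_abs (x 1), mul_nonneg (abs_nonneg (x 0)) (abs_nonneg (x 1))]

/-! ### Sectors in abscissa–slope coordinates -/

/-- The truncated sector `{a < x₀ < b, |x₁| < x₀}`. -/
def sector (a b : ℝ) : Set Plane := {x | a < x 0 ∧ x 0 < b ∧ |x 1| < x 0}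

lemma isOpen_sector (a b : ℝ) : IsOpen (sector a b) := by
  have h0 : Continuous fun x : Plane => x 0 := by fun_prop
  have h1 : Continuous fun x : Plane => x 1 := by fun_prop
  exact (isOpen_lt continuous_const h0).inter
    ((isOpen_lt h0 continuous_const).inter (isOpen_lt h1.abs h0))

lemma measurableSet_sector (a b : ℝ) : MeasurableSet (sector a b) :=
  (isOpen_sector a b).measurableSet

/-- Sector coordinates: abscissa and slope. -/
def slopeMap (z : ℝ × ℝ) : ℝ × ℝ := (z.1, z.1 * z.2)

/-- The derivative of `slopeMap`. -/
def slopeMapDeriv (z : ℝ × ℝ) : ℝ × ℝ →L[ℝ] ℝ × ℝ :=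
  (Matrix.toLin (.finTwoProd ℝ) (.finTwoProd ℝ) !![1, 0; z.2, z.1]).toContinuousLinearMap

lemma hasFDerivAt_slopeMap (z : ℝ × ℝ) : HasFDerivAt slopeMap (slopeMapDeriv z) z := by
  unfold slopeMapDeriv
  rw [Matrix.toLin_finTwoProd_toContinuousLinearMap]
  have h1 : HasFDerivAt (fun z : ℝ × ℝ => z.1) (ContinuousLinearMap.fst ℝ ℝ ℝ) z := hasFDerivAt_fst
  have h2 : HasFDerivAt (fun z : ℝ × ℝ => z.2) (ContinuousLinearMap.snd ℝ ℝ ℝ) z := hasFDerivAt_snd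
  convert! h1.prodMk (h1.fun_mul h2) using 2 <;> simp [add_comm]

lemma det_slopeMapDeriv (z : ℝ × ℝ) : (slopeMapDeriv z).det = z.1 := by
  unfold slopeMapDeriv
  simp only [LinearMap.det_toContinuousLinearMap, LinearMap.det_toLin, Matrix.det_fin_two_of]
  ring

lemma injOn_slopeMap {a b : ℝ} (ha : 0 ≤ a) : InjOn slopeMap (Ioo a b ×ˢ Ioo (-1) 1) := by
  rintro ⟨u, t⟩ h ⟨u', t'⟩ h' heq
  simp only [slopeMap, Prod.mk.injEq] at heq
  simp only [mem_prod, mem_Ioo] at h h'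
  obtain ⟨rfl, h2⟩ := heq
  have : u ≠ 0 := by linarith [h.1.1] |> fun h : 0 < u => h.ne'
  simp [mul_left_cancel₀ this h2]

lemma planeMk_preimage_sector {a b : ℝ} (ha : 0 ≤ a) :
    planeMk ⁻¹' sector a b = slopeMap '' (Ioo a b ×ˢ Ioo (-1) 1) := by
  ext ⟨u, v⟩
  simp only [sector, mem_preimage, mem_ofPred_eq, planeMk_zero, planeMk_one, mem_image, slopeMap,
    Prod.exists, mem_prod, mem_Ioo, Prod.mk.injEq]
  constructor
  · rintro ⟨h1, h2, h3⟩
    have hu : 0 < u := by linarith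
    rw [abs_lt] at h3
    refine ⟨u, v / u, ⟨⟨h1, h2⟩, ?_, ?_⟩, rfl, by field_simp⟩
    · rw [lt_div_iff₀ hu]; linarith
    · rw [div_lt_iff₀ hu]; linarith
  · rintro ⟨u', t, ⟨⟨h1, h2⟩, h3, h4⟩, rfl, rfl⟩
    have hu : 0 < u' := by linarith
    refine ⟨h1, h2, ?_⟩
    rw [abs_lt]
    constructor <;> nlinarith

section
variable {F : Type*} [NormedAddCommGroup F] [NormedSpace ℝ F]

/-- The slope coordinates blow the vertex up to a side of a rectangle. Their Jacobian `z.1` cancels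
an inverse-distance singularity, so singular fields on a sector become smooth ones on a rectangle.
-/
lemma integrableOn_sector_iff {a b : ℝ} (ha : 0 ≤ a) (f : Plane → F) :
    IntegrableOn f (sector a b) ↔
      IntegrableOn (fun z : ℝ × ℝ => z.1 • f (planeMk (slopeMap z))) (Ioo a b ×ˢ Ioo (-1) 1) := by
  rw [← measurePreserving_planeMk.integrableOn_comp_preimage measurableEmbedding_planeMk,
    planeMk_preimage_sector ha,
    integrableOn_image_iff_integrableOn_abs_det_fderiv_smul volume
      (measurableSet_Ioo.prod measurableSet_Ioo)
      (fun z _ => (hasFDerivAt_slopeMap z).hasFDerivWithinAt) (injOn_slopeMap ha)]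
  refine integrableOn_congr_fun (fun z hz => ?_) (measurableSet_Ioo.prod measurableSet_Ioo)
  have hz1 : 0 ≤ z.1 := by linarith [hz.1.1]
  simp [det_slopeMapDeriv, abs_of_nonneg hz1]

lemma setIntegral_sector {a b : ℝ} (ha : 0 ≤ a) (f : Plane → F) :
    ∫ x in sector a b, f x =
      ∫ z in Ioo a b ×ˢ Ioo (-1) 1, z.1 • f (planeMk (slopeMap z)) := by
  rw [← measurePreserving_planeMk.setIntegral_preimage_emb measurableEmbedding_planeMk,
    planeMk_preimage_sector ha,
    integral_image_eq_integral_abs_det_fderiv_smul volume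
      (measurableSet_Ioo.prod measurableSet_Ioo)
      (fun z _ => (hasFDerivAt_slopeMap z).hasFDerivWithinAt) (injOn_slopeMap ha)]
  refine setIntegral_congr_fun (measurableSet_Ioo.prod measurableSet_Ioo) (fun z hz => ?_)
  have hz1 : 0 ≤ z.1 := by linarith [hz.1.1]
  simp [det_slopeMapDeriv, abs_of_nonneg hz1]

end

/-! ### The divergence theorem on rectangles -/

lemma Ioo_prod_Ioo_ae_eq_Icc (a b c d : ℝ) :
    (Ioo a b ×ˢ Ioo c d : Set (ℝ × ℝ)) =ᵐ[volume] Icc (a, c) (b, d) := by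
  rw [Icc_prod_eq]
  exact Measure.set_prod_ae_eq Ioo_ae_eq_Icc Ioo_ae_eq_Icc

lemma integrableOn_Ioo_prod_of_continuous {F : Type*} [NormedAddCommGroup F]
    {f : ℝ × ℝ → F} (hf : Continuous f) (a b c d : ℝ) :
    IntegrableOn f (Ioo a b ×ˢ Ioo c d) := by
  refine (hf.continuousOn.integrableOn_compact (K := Icc (a, c) (b, d)) isCompact_Icc).mono_set ?_
  rw [Icc_prod_eq]
  exact prod_mono Ioo_subset_Icc_self Ioo_subset_Icc_self

/-- The divergence theorem for a `C¹` field on an open rectangle. -/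
lemma setIntegral_div_rectangle {P Q : ℝ × ℝ → ℝ} (hP : ContDiff ℝ 1 P) (hQ : ContDiff ℝ 1 Q)
    {a b c d : ℝ} (hab : a ≤ b) (hcd : c ≤ d) :
    ∫ z in Ioo a b ×ˢ Ioo c d, (fderiv ℝ P z (1, 0) + fderiv ℝ Q z (0, 1)) =
      (((∫ x in a..b, Q (x, d)) - ∫ x in a..b, Q (x, c)) + ∫ y in c..d, P (b, y)) -
        ∫ y in c..d, P (a, y) := by
  rw [setIntegral_congr_set (Ioo_prod_Ioo_ae_eq_Icc a b c d)]
  have hPc := hP.continuous_fderiv (by norm_num)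
  have hQc := hQ.continuous_fderiv (by norm_num)
  refine integral_divergence_prod_Icc_of_hasFDerivAt_of_le P Q (fderiv ℝ P) (fderiv ℝ Q)
    (a, c) (b, d) ⟨hab, hcd⟩ hP.continuous.continuousOn hQ.continuous.continuousOn
    (fun x _ => (hP.differentiable (by norm_num) x).hasFDerivAt)
    (fun x _ => (hQ.differentiable (by norm_num) x).hasFDerivAt) ?_
  refine ContinuousOn.integrableOn_compact isCompact_Icc (Continuous.continuousOn ?_)
  fun_prop

/-- The divergence theorem on an open rectangle, with partial derivatives given pointwise. -/
lemma setIntegral_div_rectangle_of_hasDerivAt {P Q P' Q' : ℝ × ℝ → ℝ}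
    (hP : ContDiff ℝ 1 P) (hQ : ContDiff ℝ 1 Q)
    (hP' : ∀ z, HasDerivAt (fun u => P (u, z.2)) (P' z) z.1)
    (hQ' : ∀ z, HasDerivAt (fun t => Q (z.1, t)) (Q' z) z.2)
    {a b c d : ℝ} (hab : a ≤ b) (hcd : c ≤ d) :
    ∫ z in Ioo a b ×ˢ Ioo c d, (P' z + Q' z) =
      (((∫ x in a..b, Q (x, d)) - ∫ x in a..b, Q (x, c)) + ∫ y in c..d, P (b, y)) -
        ∫ y in c..d, P (a, y) := by
  rw [← setIntegral_div_rectangle hP hQ hab hcd]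
  congr 1
  funext z
  have h1 : HasDerivAt (fun u => P (u, z.2)) (fderiv ℝ P z (1, 0)) z.1 := by
    have h : HasFDerivAt P (fderiv ℝ P z) (z.1, z.2) :=
      (hP.differentiable (by norm_num) z).hasFDerivAt
    exact h.comp_hasDerivAt z.1 ((hasDerivAt_id z.1).prodMk (hasDerivAt_const z.1 z.2))
  have h2 : HasDerivAt (fun t => Q (z.1, t)) (fderiv ℝ Q z (0, 1)) z.2 := by
    have h : HasFDerivAt Q (fderiv ℝ Q z) (z.1, z.2) :=
      (hQ.differentiable (by norm_num) z).hasFDerivAt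
    exact h.comp_hasDerivAt z.2 ((hasDerivAt_const z.2 z.1).prodMk (hasDerivAt_id z.2))
  rw [(hP' z).unique h1, (hQ' z).unique h2]

/-! ### Weak divergence equations with a point charge and a background -/

/-- `E` is locally integrable and `-div E = c δ_p - 2π 1_S` in the sense of distributions. -/
structure HasSource (E : Plane → Plane) (c : ℝ) (p : Plane) (S : Set Plane) : Prop where
  locallyIntegrable : LocallyIntegrable E volume
  weak : ∀ φ : Plane → ℝ, ContDiff ℝ (⊤ : ℕ∞) φ → HasCompactSupport φ →
    ∫ x, fderiv ℝ φ x (E x) = c * φ p - 2 * Real.pi * ∫ x in S, φ x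

lemma integrable_fderiv_apply {E : Plane → Plane} (hE : LocallyIntegrable E volume)
    {φ : Plane → ℝ} (hφ : ContDiff ℝ (⊤ : ℕ∞) φ) (hc : HasCompactSupport φ) :
    Integrable (fun x => fderiv ℝ φ x (E x)) := by
  have hcont : Continuous (fderiv ℝ φ) := hφ.continuous_fderiv (by simp)
  have hc' : HasCompactSupport (fderiv ℝ φ) := hc.fderiv ℝ
  obtain ⟨M, hM⟩ := hc'.exists_bound_of_continuous hcont
  have hK : IntegrableOn E (tsupport (fderiv ℝ φ)) := hE.integrableOn_isCompact hc'
  have hKm : MeasurableSet (tsupport (fderiv ℝ φ)) := (isClosed_tsupport _).measurableSet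
  have hMK : IntegrableOn (fun x => M * ‖E x‖) (tsupport (fderiv ℝ φ)) := hK.norm.const_mul M
  refine Integrable.mono' (hMK.integrable_indicator hKm) ?_ ?_
  · exact (ContinuousLinearMap.apply ℝ ℝ).aestronglyMeasurable_comp₂
      hE.aestronglyMeasurable hcont.aestronglyMeasurable
  · refine Eventually.of_forall fun x => ?_
    by_cases hx : x ∈ tsupport (fderiv ℝ φ)
    · rw [indicator_of_mem hx]
      exact (ContinuousLinearMap.le_opNorm _ _).trans
        (mul_le_mul_of_nonneg_right (hM x) (norm_nonneg _))
    · rw [indicator_of_notMem hx, image_eq_zero_of_notMem_tsupport hx]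
      simp

/-- Transport of a source by a rigid motion. -/
lemma HasSource.rigidMotion {E : Plane → Plane} {c : ℝ} {S : Set Plane}
    (h : HasSource E c 0 S) (L : Plane ≃ₗᵢ[ℝ] Plane) (p : Plane) :
    HasSource (fun x => L (E (L.symm (x - p)))) c p {x | L.symm (x - p) ∈ S} := by
  have hmp : MeasurePreserving (fun y : Plane => L y + p) :=
    (measurePreserving_add_right volume p).comp L.measurePreserving
  have hemb : MeasurableEmbedding (fun y : Plane => L y + p) :=
    (measurableEmbedding_addRight p).comp L.toMeasurableEquiv.measurableEmbedding
  constructor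
  · rw [locallyIntegrable_iff]
    intro K hK
    have hK' : IsCompact ((fun y : Plane => L y + p) ⁻¹' K) := by
      have : (fun y : Plane => L y + p) ⁻¹' K = (fun x => L.symm (x - p)) '' K := by
        ext y
        simp only [mem_preimage, mem_image]
        constructor
        · intro hy; exact ⟨_, hy, by simp⟩
        · rintro ⟨x, hx, rfl⟩; simpa using hx
      rw [this]
      exact hK.image (by fun_prop)
    rw [← hmp.integrableOn_comp_preimage hemb]
    have := h.locallyIntegrable.integrableOn_isCompact hK'
    simp only [Function.comp_def, add_sub_cancel_right, LinearIsometryEquiv.symm_apply_apply]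
    exact L.toContinuousLinearEquiv.toContinuousLinearMap.integrable_comp this
  · intro φ hφ hc
    have hψ : ContDiff ℝ (⊤ : ℕ∞) (fun y => φ (L y + p)) :=
      hφ.comp (L.contDiff.add contDiff_const)
    have hψc : HasCompactSupport (fun y => φ (L y + p)) :=
      hc.comp_homeomorph (L.toHomeomorph.trans (Homeomorph.addRight p))
    have hw := h.weak _ hψ hψc
    rw [← hmp.integral_comp hemb,
      ← hmp.setIntegral_preimage_emb hemb φ {x | L.symm (x - p) ∈ S}]
    have hS : (fun y : Plane => L y + p) ⁻¹' {x | L.symm (x - p) ∈ S} = S := by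
      ext y; simp
    rw [hS]
    have hd : ∀ y, fderiv ℝ (fun y => φ (L y + p)) y (E y)
        = fderiv ℝ φ (L y + p) (L (E (L.symm (L y + p - p)))) := by
      intro y
      have h1 : HasFDerivAt (fun y : Plane => L y + p)
          (L.toContinuousLinearEquiv.toContinuousLinearMap) y :=
        (L.toContinuousLinearEquiv.toContinuousLinearMap.hasFDerivAt).add_const p
      have h2 : HasFDerivAt φ (fderiv ℝ φ (L y + p)) (L y + p) :=
        (hφ.differentiable (by simp) _).hasFDerivAt
      have h3 : HasFDerivAt (fun y => φ (L y + p)) _ y := h2.comp y h1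
      rw [h3.fderiv]
      simp
    simp only [hd] at hw
    rw [hw]
    simp

/-! ### The charged quarter cell -/

/-- Right quarter of the field of a charged lattice cell. -/
def triField : Plane → Plane := (sector 0 (1 / 2)).indicator fun x =>
  planeMk (-(1 - 4 * x 0 ^ 2) * x 0 / (x 0 ^ 2 + x 1 ^ 2),
    -(1 - 4 * x 0 ^ 2) * x 1 / (x 0 ^ 2 + x 1 ^ 2)
      + (2 * Real.pi * x 1 - 8 * x 0 * Real.arctan (x 1 / x 0)))

lemma mem_sector_slopeMap {a b : ℝ} (ha : 0 ≤ a) {z : ℝ × ℝ} (hz : z ∈ Ioo a b ×ˢ Ioo (-1) 1) :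
    planeMk (slopeMap z) ∈ sector a b := by
  have : slopeMap z ∈ planeMk ⁻¹' sector a b := by
    rw [planeMk_preimage_sector ha]; exact mem_image_of_mem _ hz
  exact this

/-- The two vectors on the right are the images of the coordinate directions of abscissa and slope,
so their coefficients are the components to which the divergence theorem on the rectangle applies.
Both are smooth up to the vertex. -/
lemma smul_triField {z : ℝ × ℝ} (hz : z ∈ Ioo (0 : ℝ) (1 / 2) ×ˢ Ioo (-1 : ℝ) 1) :
    z.1 • triField (planeMk (slopeMap z)) =
      (-(1 - 4 * z.1 ^ 2) / (1 + z.2 ^ 2)) • planeMk (1, z.2) +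
        (z.1 * (2 * Real.pi * z.2 - 8 * Real.arctan z.2)) • planeMk (0, z.1) := by
  rw [triField, indicator_of_mem (mem_sector_slopeMap le_rfl hz)]
  have hz0 : z.1 ≠ 0 := hz.1.1.ne'
  have h1 : 1 + z.2 ^ 2 ≠ 0 := by positivity
  have h2 : z.1 ^ 2 + (z.1 * z.2) ^ 2 = z.1 ^ 2 * (1 + z.2 ^ 2) := by ring
  ext i
  fin_cases i
  · simp only [slopeMap, planeMk_zero, planeMk_one, h2, Fin.zero_eta, PiLp.smul_apply,
      PiLp.add_apply, smul_eq_mul, mul_zero, add_zero, mul_one]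
    field_simp
  · simp only [slopeMap, planeMk_zero, planeMk_one, h2, Fin.mk_one, PiLp.smul_apply,
      PiLp.add_apply, smul_eq_mul, mul_div_cancel_left₀ _ hz0]
    field_simp

lemma contDiff_slopeMap {n : WithTop ℕ∞} : ContDiff ℝ n slopeMap := by
  unfold slopeMap; fun_prop

lemma integrable_triField : Integrable triField := by
  rw [triField, integrable_indicator_iff (measurableSet_sector _ _)]
  have : IntegrableOn triField (sector 0 (1 / 2)) := by
    rw [integrableOn_sector_iff le_rfl]
    refine (integrableOn_congr_fun (fun z hz => smul_triField hz)
      (measurableSet_Ioo.prod measurableSet_Ioo)).2 ?_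
    refine integrableOn_Ioo_prod_of_continuous ?_ _ _ _ _
    have : ∀ z : ℝ × ℝ, 1 + z.2 ^ 2 ≠ 0 := fun z => by positivity
    fun_prop (disch := assumption)
  exact (integrableOn_congr_fun (fun x hx => by rw [triField, indicator_of_mem hx])
    (measurableSet_sector _ _)).1 this

lemma hasDerivAt_slope_fst {φ : Plane → ℝ} (hφ : Differentiable ℝ φ) (z : ℝ × ℝ) :
    HasDerivAt (fun u => φ (planeMk (slopeMap (u, z.2))))
      (fderiv ℝ φ (planeMk (slopeMap z)) (planeMk (1, z.2))) z.1 := by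
  have h2 : HasFDerivAt φ (fderiv ℝ φ (planeMk (slopeMap z))) (planeMk (slopeMap (z.1, z.2))) :=
    (hφ _).hasFDerivAt
  have h1 : HasDerivAt (fun u : ℝ => planeMk (slopeMap (u, z.2))) (planeMk (1, z.2)) z.1 := by
    have h3 : HasDerivAt (fun u : ℝ => slopeMap (u, z.2)) (1, z.2) z.1 := by
      refine (hasDerivAt_id z.1).prodMk ?_
      simpa using (hasDerivAt_id z.1).mul_const z.2
    exact planeMkL.hasFDerivAt.comp_hasDerivAt z.1 h3
  exact h2.comp_hasDerivAt z.1 h1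

lemma hasDerivAt_slope_snd {φ : Plane → ℝ} (hφ : Differentiable ℝ φ) (z : ℝ × ℝ) :
    HasDerivAt (fun t => φ (planeMk (slopeMap (z.1, t))))
      (fderiv ℝ φ (planeMk (slopeMap z)) (planeMk (0, z.1))) z.2 := by
  have h2 : HasFDerivAt φ (fderiv ℝ φ (planeMk (slopeMap z))) (planeMk (slopeMap (z.1, z.2))) :=
    (hφ _).hasFDerivAt
  have h1 : HasDerivAt (fun t : ℝ => planeMk (slopeMap (z.1, t))) (planeMk (0, z.1)) z.2 := by
    have h3 : HasDerivAt (fun t : ℝ => slopeMap (z.1, t)) (0, z.1) z.2 := by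
      refine (hasDerivAt_const z.2 z.1).prodMk ?_
      simpa using (hasDerivAt_id z.2).const_mul z.1
    exact planeMkL.hasFDerivAt.comp_hasDerivAt z.2 h3
  exact h2.comp_hasDerivAt z.2 h1

/-- In slope coordinates the components are `-(1 - 4u²)/(1 + t²)` and `u(2πt - 8 arctan t)`. Their
divergence is `2πu`, which is `2π` times the Jacobian. The flux vanishes at `u = 1/2` and at `t =
±1`; only the side `u = 0`, the blown-up vertex, contributes, through the integral of `1/(1 + t²)`
over `(-1, 1)`, which is `π/2`. -/
lemma hasSource_triField : HasSource triField (Real.pi / 2) 0 (sector 0 (1 / 2)) := by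
  refine ⟨integrable_triField.locallyIntegrable, fun φ hφ hc => ?_⟩
  have hdiff : Differentiable ℝ φ := hφ.differentiable (by simp)
  have hφ1 : ContDiff ℝ 1 φ := hφ.of_le (by simp)
  set ψ : ℝ × ℝ → ℝ := fun z => φ (planeMk (slopeMap z)) with hψ
  have hψs : ContDiff ℝ 1 ψ := hφ1.comp (contDiff_planeMk.comp contDiff_slopeMap)
  have hden : ∀ z : ℝ × ℝ, 1 + z.2 ^ 2 ≠ 0 := fun z => by positivity
  have hP : ContDiff ℝ 1 (fun z : ℝ × ℝ => -(1 - 4 * z.1 ^ 2) / (1 + z.2 ^ 2) * ψ z) := by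
    refine ContDiff.mul (ContDiff.div (by fun_prop) (by fun_prop) hden) hψs
  have hQ : ContDiff ℝ 1 (fun z : ℝ × ℝ =>
      z.1 * (2 * Real.pi * z.2 - 8 * Real.arctan z.2) * ψ z) := by
    have : ContDiff ℝ 1 (fun z : ℝ × ℝ => Real.arctan z.2) := contDiff_snd.arctan
    fun_prop
  have key := setIntegral_div_rectangle_of_hasDerivAt hP hQ
    (P' := fun z => 8 * z.1 / (1 + z.2 ^ 2) * ψ z + -(1 - 4 * z.1 ^ 2) / (1 + z.2 ^ 2) *
      fderiv ℝ φ (planeMk (slopeMap z)) (planeMk (1, z.2)))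
    (Q' := fun z => z.1 * (2 * Real.pi - 8 * (1 / (1 + z.2 ^ 2))) * ψ z +
      z.1 * (2 * Real.pi * z.2 - 8 * Real.arctan z.2) *
      fderiv ℝ φ (planeMk (slopeMap z)) (planeMk (0, z.1)))
    (fun z => by
      refine HasDerivAt.fun_mul ?_ (hasDerivAt_slope_fst hdiff z)
      have := ((((hasDerivAt_pow 2 z.1).const_mul 4).const_sub 1).fun_neg).div_const (1 + z.2 ^ 2)
      convert! this using 1
      norm_num; ring)
    (fun z => by
      refine HasDerivAt.fun_mul ?_ (hasDerivAt_slope_snd hdiff z)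
      have := ((((hasDerivAt_id z.2).const_mul (2 * Real.pi)).fun_sub
        ((Real.hasDerivAt_arctan z.2).const_mul 8))).const_mul z.1
      convert! this using 1
      norm_num)
    (a := 0) (b := 1 / 2) (c := -1) (d := 1) (by norm_num) (by norm_num)
  have hI1 : IntegrableOn (fun z : ℝ × ℝ =>
      z.1 • fderiv ℝ φ (planeMk (slopeMap z)) (triField (planeMk (slopeMap z))))
      (Ioo 0 (1 / 2) ×ˢ Ioo (-1) 1) := by
    have := (integrable_fderiv_apply integrable_triField.locallyIntegrable hφ hc).integrableOn
      (s := sector 0 (1 / 2))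
    rwa [integrableOn_sector_iff le_rfl] at this
  have hI2 : IntegrableOn (fun z : ℝ × ℝ => z.1 • φ (planeMk (slopeMap z)))
      (Ioo 0 (1 / 2) ×ˢ Ioo (-1) 1) := by
    refine integrableOn_Ioo_prod_of_continuous ?_ _ _ _ _
    exact continuous_fst.smul hψs.continuous
  have e1 : ∫ x, fderiv ℝ φ x (triField x) = ∫ x in sector 0 (1 / 2), fderiv ℝ φ x (triField x) := by
    rw [setIntegral_eq_integral_of_forall_compl_eq_zero]
    intro x hx
    rw [triField, indicator_of_notMem hx, map_zero]
  rw [e1, setIntegral_sector le_rfl, setIntegral_sector le_rfl, eq_sub_iff_add_eq,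
    ← integral_const_mul, ← integral_add hI1 (hI2.const_mul _)]
  refine Eq.trans (Eq.trans (setIntegral_congr_fun (measurableSet_Ioo.prod measurableSet_Ioo)
    (fun z hz => ?_)) key) ?_
  · simp only [smul_eq_mul]
    rw [← smul_eq_mul z.1 (fderiv ℝ φ _ _), ← map_smul, smul_triField hz]
    have := hden z
    simp only [map_add, map_smul, smul_eq_mul, hψ]
    field_simp
    ring
  have hψ0 : ∀ t : ℝ, ψ (0, t) = φ 0 := by
    intro t
    have : planeMk (slopeMap (0, t)) = 0 := by
      ext i; fin_cases i <;> simp [slopeMap]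
    simp [hψ, this]
  -- No flux crosses the slanted sides: the coefficient `2π` matches `8 * (π/4)`.
  have hz1 : (2 * Real.pi * 1 - 8 * Real.arctan 1) = 0 := by rw [Real.arctan_one]; ring
  have hz2 : (2 * Real.pi * (-1) - 8 * Real.arctan (-1)) = 0 := by
    rw [Real.arctan_neg, Real.arctan_one]; ring
  simp only [hz1, hz2, hψ0]
  norm_num
  simp only [neg_div, one_div]
  rw [intervalIntegral.integral_neg, integral_inv_one_add_sq, Real.arctan_neg, Real.arctan_one]
  ring

/-! ### The jet of a vacant cell -/

/-- The open unit square centred at the origin. -/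
def unitCell : Set Plane := {x | |x 0| < 1 / 2 ∧ |x 1| < 1 / 2}

/-- The part of the cone `|x₁| < x₀` to the right of the unit cell. -/
def outerSector : Set Plane := {x | 1 / 2 < x 0 ∧ |x 1| < x 0}

lemma isOpen_unitCell : IsOpen unitCell := by
  have h0 : Continuous fun x : Plane => x 0 := by fun_prop
  have h1 : Continuous fun x : Plane => x 1 := by fun_prop
  exact (isOpen_lt h0.abs continuous_const).inter (isOpen_lt h1.abs continuous_const)

lemma isOpen_outerSector : IsOpen outerSector := by
  have h0 : Continuous fun x : Plane => x 0 := by fun_prop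
  have h1 : Continuous fun x : Plane => x 1 := by fun_prop
  exact (isOpen_lt continuous_const h0).inter (isOpen_lt h1.abs h0)

/-- A bounded field carrying the mass of the unit cell to infinity inside a cone. -/
def jetField (x : Plane) : Plane :=
  unitCell.indicator (fun x => planeMk (2 * Real.pi * (x 0 + 1 / 2), 0)) x +
    outerSector.indicator (fun x => planeMk (Real.pi / x 0, Real.pi * x 1 / x 0 ^ 2)) x

lemma disjoint_unitCell_outerSector : Disjoint unitCell outerSector := by
  rw [Set.disjoint_left]
  rintro x ⟨h1, _⟩ ⟨h2, _⟩
  linarith [abs_lt.1 h1]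

lemma jetField_of_mem_unitCell {x : Plane} (hx : x ∈ unitCell) :
    jetField x = planeMk (2 * Real.pi * (x 0 + 1 / 2), 0) := by
  rw [jetField, indicator_of_mem hx,
    indicator_of_notMem (Set.disjoint_left.1 disjoint_unitCell_outerSector hx), add_zero]

lemma jetField_of_mem_outerSector {x : Plane} (hx : x ∈ outerSector) :
    jetField x = planeMk (Real.pi / x 0, Real.pi * x 1 / x 0 ^ 2) := by
  rw [jetField, indicator_of_mem hx,
    indicator_of_notMem (Set.disjoint_right.1 disjoint_unitCell_outerSector hx), zero_add]

lemma jetField_eq_zero {x : Plane} (h1 : x ∉ unitCell) (h2 : x ∉ outerSector) :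
    jetField x = 0 := by
  rw [jetField, indicator_of_notMem h1, indicator_of_notMem h2, add_zero]

@[fun_prop] lemma measurable_planeMk : Measurable planeMk := continuous_planeMk.measurable

lemma measurable_jetField : Measurable jetField := by
  unfold jetField
  refine Measurable.add (Measurable.indicator ?_ isOpen_unitCell.measurableSet)
    (Measurable.indicator ?_ isOpen_outerSector.measurableSet)
  · fun_prop
  · fun_prop

/-- The sup norm is used because the decay is later compared with the Chebyshev distance between
cells. -/
lemma norm_jetField_le (x : Plane) : ‖jetField x‖ ≤ 16 / (1 / 2 + max |x 0| |x 1|) := by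
  have hpi := Real.pi_lt_four
  have hpos := Real.pi_pos
  by_cases h1 : x ∈ unitCell
  · rw [jetField_of_mem_unitCell h1]
    refine (norm_le_abs_add_abs _).trans ?_
    obtain ⟨h0, h0'⟩ := h1
    have hm : max |x 0| |x 1| < 1 / 2 := max_lt h0 h0'
    have hm0 : 0 ≤ max |x 0| |x 1| := le_max_of_le_left (abs_nonneg _)
    rw [abs_lt] at h0
    rw [planeMk_zero, planeMk_one, abs_zero, add_zero, abs_of_nonneg (by nlinarith),
      le_div_iff₀ (by linarith)]
    have : 2 * Real.pi * (x 0 + 1 / 2) ≤ 8 := by nlinarith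
    nlinarith
  by_cases h2 : x ∈ outerSector
  · rw [jetField_of_mem_outerSector h2]
    refine (norm_le_abs_add_abs _).trans ?_
    obtain ⟨h0, h0'⟩ := h2
    have hx0 : 0 < x 0 := by linarith
    have hm : max |x 0| |x 1| = x 0 := by
      rw [abs_of_pos hx0]; exact max_eq_left h0'.le
    rw [hm, planeMk_zero, planeMk_one, abs_div, abs_div, abs_mul, abs_of_pos hx0,
      abs_of_pos hpos, abs_of_pos (pow_pos hx0 2)]
    have : Real.pi * |x 1| / x 0 ^ 2 ≤ Real.pi / x 0 := by
      rw [div_le_div_iff₀ (by positivity) hx0]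
      nlinarith [mul_pos hpos hx0]
    have h3 : 2 * (Real.pi / x 0) ≤ 16 / (1 / 2 + x 0) := by
      rw [← mul_div_assoc, div_le_div_iff₀ hx0 (by linarith)]
      nlinarith
    linarith
  · rw [jetField_eq_zero h1 h2, norm_zero]
    positivity

lemma norm_jetField_le_const (x : Plane) : ‖jetField x‖ ≤ 32 := by
  refine (norm_jetField_le x).trans ?_
  have : 0 ≤ max |x 0| |x 1| := le_max_of_le_left (abs_nonneg _)
  rw [div_le_iff₀ (by linarith)]
  linarith

lemma locallyIntegrable_jetField : LocallyIntegrable jetField volume :=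
  (memLp_top_of_bound measurable_jetField.aestronglyMeasurable 32
    (Eventually.of_forall norm_jetField_le_const)).locallyIntegrable le_top

lemma preimage_unitCell :
    planeMk ⁻¹' unitCell = Ioo (-(1 / 2)) (1 / 2) ×ˢ Ioo (-(1 / 2)) (1 / 2) := by
  ext z
  simp [unitCell, abs_lt]

/-- The field is horizontal and vanishes on the left side, so all the mass of the cell leaves
through the right side. -/
lemma setIntegral_unitCell_jetField {φ : Plane → ℝ} (hφ : ContDiff ℝ (⊤ : ℕ∞) φ)
    (hc : HasCompactSupport φ) :
    ∫ x in unitCell, fderiv ℝ φ x (jetField x) =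
      2 * Real.pi * (∫ v in (-(1 / 2) : ℝ)..(1 / 2), φ (planeMk (1 / 2, v))) -
        2 * Real.pi * ∫ x in unitCell, φ x := by
  have hdiff : Differentiable ℝ φ := hφ.differentiable (by simp)
  have hφ1 : ContDiff ℝ 1 φ := hφ.of_le (by simp)
  have hψs : ContDiff ℝ 1 (fun z => φ (planeMk z)) := hφ1.comp contDiff_planeMk
  have hP : ContDiff ℝ 1 (fun z : ℝ × ℝ => 2 * Real.pi * (z.1 + 1 / 2) * φ (planeMk z)) :=
    ContDiff.mul (by fun_prop) hψs
  have key := setIntegral_div_rectangle_of_hasDerivAt hP (contDiff_const (c := (0 : ℝ)))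
    (P' := fun z => 2 * Real.pi * φ (planeMk z) + 2 * Real.pi * (z.1 + 1 / 2) *
      fderiv ℝ φ (planeMk z) (planeMk (1, 0))) (Q' := fun _ => 0)
    (fun z => by
      refine HasDerivAt.fun_mul ?_ ?_
      · simpa only [mul_one, id] using ((hasDerivAt_id z.1).add_const (1 / 2)).const_mul (2 * Real.pi)
      · have h2 : HasFDerivAt φ (fderiv ℝ φ (planeMk z)) (planeMk (z.1, z.2)) :=
          (hdiff _).hasFDerivAt
        exact h2.comp_hasDerivAt z.1 (planeMkL.hasFDerivAt.comp_hasDerivAt z.1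
          ((hasDerivAt_id z.1).prodMk (hasDerivAt_const z.1 z.2))))
    (fun z => hasDerivAt_const _ _)
    (a := -(1 / 2)) (b := 1 / 2) (c := -(1 / 2)) (d := 1 / 2) (by norm_num) (by norm_num)
  have hI1 := (integrable_fderiv_apply locallyIntegrable_jetField hφ hc).integrableOn
    (s := unitCell)
  have hI2 := (hφ.continuous.integrable_of_hasCompactSupport hc (μ := volume)).integrableOn
    (s := unitCell)
  rw [eq_sub_iff_add_eq, ← integral_const_mul, ← integral_add hI1 (hI2.const_mul _),
    ← measurePreserving_planeMk.setIntegral_preimage_emb measurableEmbedding_planeMk,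
    preimage_unitCell]
  refine Eq.trans (Eq.trans (setIntegral_congr_fun (measurableSet_Ioo.prod measurableSet_Ioo)
    (fun z hz => ?_)) key) ?_
  · have hz' : planeMk z ∈ unitCell := by
      rw [← mem_preimage, preimage_unitCell]; exact hz
    have : planeMk (2 * Real.pi * (z.1 + 1 / 2), 0) =
        (2 * Real.pi * (z.1 + 1 / 2)) • planeMk (1, 0) := by
      ext i; fin_cases i <;> simp
    simp only [jetField_of_mem_unitCell hz', planeMk_zero, this, map_smul, smul_eq_mul]
    ring
  · norm_num

/-- In slope coordinates the jet times the Jacobian is the constant `π` along the abscissa: it is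
divergence-free and tangent to the cone. The only boundary term is the inflow through the right side
of the cell, opposite to the outflow of the cell. -/
lemma setIntegral_outerSector_jetField {φ : Plane → ℝ} (hφ : ContDiff ℝ (⊤ : ℕ∞) φ)
    (hc : HasCompactSupport φ) :
    ∫ x in outerSector, fderiv ℝ φ x (jetField x) =
      -(2 * Real.pi * (∫ v in (-(1 / 2) : ℝ)..(1 / 2), φ (planeMk (1 / 2, v)))) := by
  have hdiff : Differentiable ℝ φ := hφ.differentiable (by simp)
  have hφ1 : ContDiff ℝ 1 φ := hφ.of_le (by simp)
  obtain ⟨r, hr⟩ := hc.isCompact.isBounded.subset_closedBall 0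
  -- The cone is truncated beyond the support of the test function, so the far side carries no flux.
  set b := max r 1 + 1 with hb
  have hb1 : (1 : ℝ) ≤ b := by linarith [le_max_right r 1]
  have hout : ∀ x : Plane, b ≤ x 0 → x ∉ tsupport φ := by
    intro x hx hx'
    have := hr hx'
    rw [mem_closedBall_zero_iff] at this
    linarith [le_max_left r 1, abs_coord_le_norm x 0, le_abs_self (x 0)]
  have hsub : sector (1 / 2) b ⊆ outerSector := fun x hx => ⟨hx.1, hx.2.2⟩
  rw [setIntegral_eq_of_subset_of_forall_sdiff_eq_zero isOpen_outerSector.measurableSet hsub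
    (fun x hx => ?_)]
  swap
  · have : b ≤ x 0 := by
      by_contra! h
      exact hx.2 ⟨hx.1.1, h, hx.1.2⟩
    rw [image_eq_zero_of_notMem_tsupport (fun h => hout x this (tsupport_fderiv_subset ℝ h))]
    simp
  have hψs : ContDiff ℝ 1 (fun z => φ (planeMk (slopeMap z))) :=
    hφ1.comp (contDiff_planeMk.comp contDiff_slopeMap)
  have hP : ContDiff ℝ 1 (fun z : ℝ × ℝ => Real.pi * φ (planeMk (slopeMap z))) :=
    contDiff_const.mul hψs
  have key := setIntegral_div_rectangle_of_hasDerivAt hP (contDiff_const (c := (0 : ℝ)))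
    (P' := fun z => Real.pi * fderiv ℝ φ (planeMk (slopeMap z)) (planeMk (1, z.2)))
    (Q' := fun _ => 0)
    (fun z => (hasDerivAt_slope_fst hdiff z).const_mul _)
    (fun z => hasDerivAt_const _ _)
    (a := 1 / 2) (b := b) (c := -1) (d := 1) (by linarith) (by norm_num)
  rw [setIntegral_sector (by norm_num)]
  refine Eq.trans (Eq.trans (setIntegral_congr_fun (measurableSet_Ioo.prod measurableSet_Ioo)
    (fun z hz => ?_)) key) ?_
  · have hz' : planeMk (slopeMap z) ∈ outerSector := hsub (mem_sector_slopeMap (by norm_num) hz)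
    have hz0 : z.1 ≠ 0 := by linarith [hz.1.1] |> fun h : 0 < z.1 => h.ne'
    have : z.1 • jetField (planeMk (slopeMap z)) = Real.pi • planeMk (1, z.2) := by
      rw [jetField_of_mem_outerSector hz']
      ext i
      fin_cases i
      · simp [slopeMap]; field_simp
      · simp [slopeMap]; field_simp
    rw [← map_smul, this, map_smul, smul_eq_mul, add_zero]
  · have h0 : ∀ t : ℝ, φ (planeMk (slopeMap (b, t))) = 0 := fun t =>
      image_eq_zero_of_notMem_tsupport (hout _ (by simp [slopeMap]))
    -- At abscissa `1/2` the slope is twice the ordinate; this factor turns the density `π` into the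
    -- `2π` leaving the cell.
    have h1 : ∫ t in (-1 : ℝ)..1, φ (planeMk (1 / 2, 1 / 2 * t)) =
        2 * ∫ v in (-(1 / 2) : ℝ)..(1 / 2), φ (planeMk (1 / 2, v)) := by
      have := intervalIntegral.integral_comp_mul_left (a := -1) (b := 1)
        (fun v => φ (planeMk (1 / 2, v))) (c := (1 / 2 : ℝ)) (by norm_num)
      rw [this]
      norm_num
    simp only [h0, mul_zero, intervalIntegral.integral_zero]
    simp only [slopeMap, intervalIntegral.integral_const_mul, h1]
    ring

lemma hasSource_jetField : HasSource jetField 0 0 unitCell := by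
  refine ⟨locallyIntegrable_jetField, fun φ hφ hc => ?_⟩
  have hI := integrable_fderiv_apply locallyIntegrable_jetField hφ hc
  have h1 : ∫ x, fderiv ℝ φ x (jetField x) =
      ∫ x in unitCell ∪ outerSector, fderiv ℝ φ x (jetField x) := by
    rw [setIntegral_eq_integral_of_forall_compl_eq_zero]
    intro x hx
    rw [mem_union, not_or] at hx
    rw [jetField_eq_zero hx.1 hx.2, map_zero]
  rw [h1, setIntegral_union disjoint_unitCell_outerSector isOpen_outerSector.measurableSet
    hI.integrableOn hI.integrableOn, setIntegral_unitCell_jetField hφ hc,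
    setIntegral_outerSector_jetField hφ hc]
  ring

/-! ### The charged cell, assembled from four rotated quarters -/

/-- Rotation of the plane by a right angle. -/
def quarterTurn : Plane ≃ₗᵢ[ℝ] Plane where
  toFun x := planeMk (-x 1, x 0)
  invFun x := planeMk (x 1, -x 0)
  map_add' x y := by ext i; fin_cases i <;> simp [add_comm]
  map_smul' c x := by ext i; fin_cases i <;> simp
  left_inv x := by ext i; fin_cases i <;> simp
  right_inv x := by ext i; fin_cases i <;> simp
  norm_map' x := by
    rw [← sq_eq_sq₀ (norm_nonneg _) (norm_nonneg _), norm_planeMk_sq, norm_planeMk_sq]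
    change planeMk (-x 1, x 0) 0 ^ 2 + planeMk (-x 1, x 0) 1 ^ 2 = _
    simp only [planeMk_zero, planeMk_one]
    ring

lemma quarterTurn_apply (x : Plane) : quarterTurn x = planeMk (-x 1, x 0) := rfl
lemma quarterTurn_symm_apply (x : Plane) : quarterTurn.symm x = planeMk (x 1, -x 0) := rfl

lemma HasSource.add {E E' : Plane → Plane} {c c' : ℝ} {p : Plane} {S S' : Set Plane}
    (h : HasSource E c p S) (h' : HasSource E' c' p S') (hd : Disjoint S S')
    (hS' : MeasurableSet S') : HasSource (fun x => E x + E' x) (c + c') p (S ∪ S') := by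
  refine ⟨h.locallyIntegrable.add h'.locallyIntegrable, fun φ hφ hc => ?_⟩
  have hI := hφ.continuous.integrable_of_hasCompactSupport hc (μ := volume)
  simp only [map_add]
  rw [integral_add (integrable_fderiv_apply h.locallyIntegrable hφ hc)
    (integrable_fderiv_apply h'.locallyIntegrable hφ hc), h.weak φ hφ hc, h'.weak φ hφ hc,
    setIntegral_union hd hS' hI.integrableOn hI.integrableOn]
  ring

lemma HasSource.congr_set {E : Plane → Plane} {c : ℝ} {p : Plane} {S S' : Set Plane}
    (h : HasSource E c p S) (hS : S =ᵐ[volume] S') : HasSource E c p S' :=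
  ⟨h.locallyIntegrable, fun φ hφ hc => by rw [h.weak φ hφ hc, setIntegral_congr_set hS]⟩

lemma HasSource.linearIsometry {E : Plane → Plane} {c : ℝ} {S : Set Plane}
    (h : HasSource E c 0 S) (L : Plane ≃ₗᵢ[ℝ] Plane) :
    HasSource (fun x => L (E (L.symm x))) c 0 (L.symm ⁻¹' S) := by
  simpa only [sub_zero, preimage] using h.rigidMotion L 0

lemma HasSource.translate {E : Plane → Plane} {c : ℝ} {S : Set Plane}
    (h : HasSource E c 0 S) (p : Plane) :
    HasSource (fun x => E (x - p)) c p {x | x - p ∈ S} :=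
  h.rigidMotion (LinearIsometryEquiv.refl ℝ Plane) p

/-- The field of a unit point charge neutralised by a uniform background on the unit cell. -/
def cellField (x : Plane) : Plane :=
  triField x + quarterTurn (triField (quarterTurn.symm x)) +
    (LinearIsometryEquiv.neg ℝ) (triField ((LinearIsometryEquiv.neg ℝ).symm x)) +
    quarterTurn.symm (triField (quarterTurn.symm.symm x))

lemma volume_setOf_coord_eq (i : Fin 2) (c : ℝ) : volume {x : Plane | x i = c} = 0 := by
  have := (PiLp.volume_preserving_ofLp (Fin 2)).measure_preimage_equiv
    (f := (MeasurableEquiv.toLp 2 (Fin 2 → ℝ)).symm) {y | y i = c}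
  exact this.trans (Measure.pi_hyperplane (fun _ => (volume : Measure ℝ)) i c)

lemma volume_ker_eq_zero (l : Plane →ₗ[ℝ] ℝ) (hl : l ≠ 0) : volume {x : Plane | l x = 0} = 0 := by
  have := Measure.addHaar_submodule (volume : Measure Plane) (LinearMap.ker l)
    (fun h => hl (LinearMap.ker_eq_top.1 h))
  exact this

lemma volume_diagonals : volume {x : Plane | |x 0| = |x 1|} = 0 := by
  have h1 := volume_ker_eq_zero ((EuclideanSpace.proj 0 - EuclideanSpace.proj 1 :
    Plane →L[ℝ] ℝ) : Plane →ₗ[ℝ] ℝ) (fun h => by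
      have := congrArg (fun l => l (planeMk (1, 0))) h
      simp at this)
  have h2 := volume_ker_eq_zero ((EuclideanSpace.proj 0 + EuclideanSpace.proj 1 :
    Plane →L[ℝ] ℝ) : Plane →ₗ[ℝ] ℝ) (fun h => by
      have := congrArg (fun l => l (planeMk (1, 0))) h
      simp at this)
  refine measure_mono_null (fun x hx => ?_) (measure_union_null h1 h2)
  rcases abs_eq_abs.1 hx with h | h
  · left; simp [h]
  · right; simp [h]

/-- The four rotated sectors fill the cell up to the diagonals, a null set, and their four charges
`π/2` add up. -/
lemma hasSource_cellField : HasSource cellField (2 * Real.pi) 0 unitCell := by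
  have hm : ∀ L : Plane ≃ₗᵢ[ℝ] Plane, MeasurableSet (L ⁻¹' sector 0 (1 / 2)) := fun L =>
    ((isOpen_sector _ _).preimage L.continuous).measurableSet
  have h := ((hasSource_triField.add (hasSource_triField.linearIsometry quarterTurn) ?_
    (hm _)).add (hasSource_triField.linearIsometry (LinearIsometryEquiv.neg ℝ)) ?_ (hm _)).add
    (hasSource_triField.linearIsometry quarterTurn.symm) ?_ (hm _)
  · have hc : Real.pi / 2 + Real.pi / 2 + Real.pi / 2 + Real.pi / 2 = 2 * Real.pi := by ring
    rw [hc] at h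
    refine h.congr_set ?_
    rw [ae_eq_set]
    constructor
    · refine measure_mono_null (fun x hx => ?_) (measure_empty (μ := volume))
      refine hx.2 ?_
      rcases hx.1 with ((h | h) | h) | h <;>
      simp only [sector, mem_preimage, mem_ofPred_eq, quarterTurn_apply, quarterTurn_symm_apply,
        LinearIsometryEquiv.symm_symm, planeMk_zero, planeMk_one, LinearIsometryEquiv.symm_neg,
        LinearIsometryEquiv.coe_neg, PiLp.neg_apply, abs_lt, unitCell] at h ⊢ <;>
      refine ⟨⟨?_, ?_⟩, ?_, ?_⟩ <;> linarith
    · refine measure_mono_null (fun x hx => ?_) volume_diagonals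
      obtain ⟨⟨h0, h1⟩, h2⟩ := hx
      by_contra h3
      refine h2 ?_
      simp only [sector, mem_union, mem_preimage, mem_ofPred_eq, quarterTurn_apply,
        quarterTurn_symm_apply, LinearIsometryEquiv.symm_symm, planeMk_zero, planeMk_one, abs_neg,
        LinearIsometryEquiv.symm_neg, LinearIsometryEquiv.coe_neg, PiLp.neg_apply] at h3 ⊢
      rcases lt_or_gt_of_ne h3 with h3 | h3 <;> grind
  all_goals
    rw [Set.disjoint_left]
    intro x h h'
    simp only [sector, mem_union, mem_preimage, mem_ofPred_eq, quarterTurn_apply,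
        quarterTurn_symm_apply, LinearIsometryEquiv.symm_symm, planeMk_zero, planeMk_one,
        LinearIsometryEquiv.symm_neg, LinearIsometryEquiv.coe_neg, PiLp.neg_apply, abs_lt] at h h'
    grind

lemma triField_of_notMem {x : Plane} (hx : x ∉ sector 0 (1 / 2)) : triField x = 0 := by
  rw [triField, indicator_of_notMem hx]

lemma norm_triField_le (x : Plane) : ‖triField x‖ ≤ 1 / ‖x‖ + 12 := by
  by_cases hx : x ∈ sector 0 (1 / 2)
  swap
  · rw [triField_of_notMem hx, norm_zero]; positivity
  have hpi := Real.pi_lt_four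
  have hpos := Real.pi_pos
  rw [triField, indicator_of_mem hx]
  obtain ⟨h0, h1, h2⟩ := hx
  have hn : 0 < ‖x‖ := h0.trans_le ((le_abs_self _).trans (abs_coord_le_norm x 0))
  have : planeMk (-(1 - 4 * x 0 ^ 2) * x 0 / (x 0 ^ 2 + x 1 ^ 2),
      -(1 - 4 * x 0 ^ 2) * x 1 / (x 0 ^ 2 + x 1 ^ 2)
      + (2 * Real.pi * x 1 - 8 * x 0 * Real.arctan (x 1 / x 0))) =
      (-(1 - 4 * x 0 ^ 2) / ‖x‖ ^ 2) • x +
        planeMk (0, 2 * Real.pi * x 1 - 8 * x 0 * Real.arctan (x 1 / x 0)) := by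
    rw [norm_planeMk_sq]
    ext i; fin_cases i <;> simp <;> ring
  rw [this]
  refine (norm_add_le _ _).trans (add_le_add ?_ ?_)
  · rw [norm_smul, norm_div, norm_neg, norm_pow, norm_norm, Real.norm_eq_abs,
      abs_of_nonneg (by nlinarith)]
    rw [show ∀ a : ℝ, a / ‖x‖ ^ 2 * ‖x‖ = a / ‖x‖ from fun a => by field_simp]
    gcongr
    nlinarith
  · refine (norm_le_abs_add_abs _).trans ?_
    rw [planeMk_zero, planeMk_one, abs_zero, zero_add]
    refine (abs_sub _ _).trans ?_
    have ha : |Real.arctan (x 1 / x 0)| ≤ Real.pi / 2 :=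
      abs_le.2 ⟨(Real.neg_pi_div_two_lt_arctan _).le, (Real.arctan_lt_pi_div_two _).le⟩
    rw [abs_mul, abs_mul, abs_mul, abs_mul, abs_two, abs_of_pos hpos, abs_of_pos h0,
      abs_of_pos (by norm_num : (0 : ℝ) < 8)]
    have : 8 * x 0 * |Real.arctan (x 1 / x 0)| ≤ 4 * (Real.pi / 2) := by
      apply mul_le_mul _ ha (abs_nonneg _) (by norm_num)
      linarith
    have h3 : |x 1| ≤ 1 / 2 := by linarith
    nlinarith

lemma cellField_of_notMem {x : Plane} (hx : x ∉ unitCell) : cellField x = 0 := by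
  simp only [unitCell, mem_ofPred_eq] at hx
  rw [cellField, triField_of_notMem, triField_of_notMem, triField_of_notMem, triField_of_notMem]
  · simp
  all_goals
    simp only [sector, mem_ofPred_eq, quarterTurn_apply,
        quarterTurn_symm_apply, LinearIsometryEquiv.symm_symm, planeMk_zero, planeMk_one, abs_neg,
        LinearIsometryEquiv.symm_neg, LinearIsometryEquiv.coe_neg, PiLp.neg_apply]
    grind

/-- The rotated sectors are disjoint, so at most one of the four terms is nonzero and the bound of a
single quarter survives without a factor. -/
lemma norm_cellField_le (x : Plane) : ‖cellField x‖ ≤ 1 / ‖x‖ + 12 := by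
  have hT := fun L : Plane ≃ₗᵢ[ℝ] Plane => norm_triField_le (L x)
  simp only [LinearIsometryEquiv.norm_map] at hT
  have h1 := hT (LinearIsometryEquiv.refl ℝ Plane)
  have h2 := hT quarterTurn.symm
  have h3 := hT (LinearIsometryEquiv.neg ℝ).symm
  have h4 := hT quarterTurn.symm.symm
  have hz : ∀ y : Plane, y ∉ sector 0 (1 / 2) → ‖triField y‖ = 0 := fun y hy => by
    rw [triField_of_notMem hy, norm_zero]
  have hle : ‖cellField x‖ ≤ ‖triField x‖ + ‖triField (quarterTurn.symm x)‖ +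
      ‖triField ((LinearIsometryEquiv.neg ℝ).symm x)‖ + ‖triField (quarterTurn.symm.symm x)‖ := by
    rw [cellField]
    refine (norm_add_le _ _).trans (add_le_add ((norm_add_le _ _).trans
      (add_le_add ((norm_add_le _ _).trans (add_le_add le_rfl ?_)) ?_)) ?_) <;>
    rw [LinearIsometryEquiv.norm_map]
  refine hle.trans ?_
  rw [LinearIsometryEquiv.coe_refl, _root_.id] at h1
  by_cases a1 : x ∈ sector 0 (1 / 2)
  · rw [hz (quarterTurn.symm x), hz ((LinearIsometryEquiv.neg ℝ).symm x),
      hz (quarterTurn.symm.symm x)]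
    · linarith
    all_goals
      simp only [sector, mem_ofPred_eq, quarterTurn_apply, quarterTurn_symm_apply, planeMk_zero,
        planeMk_one, LinearIsometryEquiv.symm_symm, LinearIsometryEquiv.symm_neg,
        LinearIsometryEquiv.coe_neg, PiLp.neg_apply, abs_lt] at a1 ⊢
      grind
  by_cases a2 : quarterTurn.symm x ∈ sector 0 (1 / 2)
  · rw [hz x a1, hz ((LinearIsometryEquiv.neg ℝ).symm x), hz (quarterTurn.symm.symm x)]
    · linarith
    all_goals
      simp only [sector, mem_ofPred_eq, quarterTurn_apply, quarterTurn_symm_apply, planeMk_zero,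
        planeMk_one, LinearIsometryEquiv.symm_symm, LinearIsometryEquiv.symm_neg,
        LinearIsometryEquiv.coe_neg, PiLp.neg_apply, abs_lt] at a2 ⊢
      grind
  by_cases a3 : (LinearIsometryEquiv.neg ℝ).symm x ∈ sector 0 (1 / 2)
  · rw [hz x a1, hz (quarterTurn.symm x) a2, hz (quarterTurn.symm.symm x)]
    · linarith
    all_goals
      simp only [sector, mem_ofPred_eq, quarterTurn_apply, planeMk_zero,
        planeMk_one, LinearIsometryEquiv.symm_symm, LinearIsometryEquiv.symm_neg,
        LinearIsometryEquiv.coe_neg, PiLp.neg_apply, abs_lt] at a3 ⊢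
      grind
  rw [hz x a1, hz (quarterTurn.symm x) a2, hz _ a3]
  linarith

/-! ### Lattice points and the tiling by unit cells -/

/-- The lattice point with given integer coordinates. -/
def latPt (p : ℤ × ℤ) : Plane := planeMk (p.1, p.2)

@[simp] lemma latPt_zero (p : ℤ × ℤ) : latPt p 0 = p.1 := by simp [latPt]
@[simp] lemma latPt_one (p : ℤ × ℤ) : latPt p 1 = p.2 := by simp [latPt]

lemma latPt_injective : Function.Injective latPt := by
  intro p q h
  have := planeMk_injective h
  simp only [Prod.mk.injEq, Int.cast_inj] at this
  exact Prod.ext this.1 this.2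

lemma range_latPt : range latPt = intLattice := by
  ext x
  constructor
  · rintro ⟨p, rfl⟩ i
    fin_cases i
    · exact ⟨p.1, by simp⟩
    · exact ⟨p.2, by simp⟩
  · intro h
    obtain ⟨a, ha⟩ := h 0
    obtain ⟨b, hb⟩ := h 1
    refine ⟨(a, b), ?_⟩
    ext i; fin_cases i <;> simp [ha, hb]

/-- The lattice points of sup norm at most `n`. -/
def latBox (n : ℕ) : Finset (ℤ × ℤ) := Finset.Icc (-(n : ℤ)) n ×ˢ Finset.Icc (-(n : ℤ)) n

lemma mem_latBox {n : ℕ} {p : ℤ × ℤ} :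
    p ∈ latBox n ↔ |(p.1 : ℝ)| ≤ n ∧ |(p.2 : ℝ)| ≤ n := by
  simp only [latBox, Finset.mem_product, Finset.mem_Icc, ← abs_le]
  norm_cast

/-- The open unit cell around a lattice point. -/
def latCell (p : ℤ × ℤ) : Set Plane := {x | x - latPt p ∈ unitCell}

lemma mem_latCell {p : ℤ × ℤ} {x : Plane} :
    x ∈ latCell p ↔ |x 0 - p.1| < 1 / 2 ∧ |x 1 - p.2| < 1 / 2 := by
  simp [latCell, unitCell]

lemma isOpen_latCell (p : ℤ × ℤ) : IsOpen (latCell p) :=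
  isOpen_unitCell.preimage (continuous_sub_right (latPt p))

lemma measurableSet_latCell (p : ℤ × ℤ) : MeasurableSet (latCell p) :=
  (isOpen_latCell p).measurableSet

lemma eq_of_mem_latCell {p q : ℤ × ℤ} {x : Plane} (hp : x ∈ latCell p) (hq : x ∈ latCell q) :
    p = q := by
  rw [mem_latCell, abs_lt, abs_lt] at hp hq
  have key : ∀ a b : ℤ, (a : ℝ) - b < 1 → (b : ℝ) - a < 1 → a = b := by
    intro a b h1 h2
    have h1' : a - b < 1 := by exact_mod_cast h1
    have h2' : b - a < 1 := by exact_mod_cast h2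
    omega
  exact Prod.ext (key _ _ (by linarith) (by linarith)) (key _ _ (by linarith) (by linarith))

lemma ae_mem_latCell : ∀ᵐ x : Plane, x ∈ latCell (round (x 0), round (x 1)) := by
  have h : ∀ i : Fin 2, ∀ᵐ x : Plane, |x i - round (x i)| < 1 / 2 := by
    intro i
    have h1 : ∀ᵐ x : Plane, ∀ k : ℤ, x i ≠ (k : ℝ) + 1 / 2 := by
      rw [ae_all_iff]
      intro k
      rw [ae_iff]
      simpa using volume_setOf_coord_eq i ((k : ℝ) + 1 / 2)
    have h2 : ∀ᵐ x : Plane, ∀ k : ℤ, x i ≠ (k : ℝ) - 1 / 2 := by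
      rw [ae_all_iff]
      intro k
      rw [ae_iff]
      simpa using volume_setOf_coord_eq i ((k : ℝ) - 1 / 2)
    filter_upwards [h1, h2] with x h1 h2
    refine lt_of_le_of_ne (abs_sub_round _) fun h => ?_
    rcases (abs_eq (by norm_num)).1 h with h | h
    · exact h1 (round (x i)) (by linarith)
    · exact h2 (round (x i)) (by linarith)
  filter_upwards [h 0, h 1] with x h0 h1
  exact mem_latCell.2 ⟨h0, h1⟩

lemma round_mem_latBox {n : ℕ} {x : Plane} (h0 : |x 0| ≤ n) (h1 : |x 1| ≤ n) :
    (round (x 0), round (x 1)) ∈ latBox n := by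
  have key : ∀ r : ℝ, |r| ≤ n → |((round r : ℤ) : ℝ)| ≤ n := by
    intro r hr
    have h := abs_le.1 (abs_sub_round r)
    rw [abs_le] at hr
    have a1 : round r < (n : ℤ) + 1 := by
      have : ((round r : ℤ) : ℝ) < (n : ℝ) + 1 := by linarith
      exact_mod_cast this
    have a2 : -(n : ℤ) - 1 < round r := by
      have : -(n : ℝ) - 1 < ((round r : ℤ) : ℝ) := by linarith
      exact_mod_cast this
    have a3 : |round r| ≤ (n : ℤ) := abs_le.2 ⟨by omega, by omega⟩
    exact_mod_cast a3
  exact mem_latBox.2 ⟨key _ h0, key _ h1⟩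

lemma latBox_mono {m n : ℕ} (h : m ≤ n) : latBox m ⊆ latBox n := by
  intro p hp
  rw [mem_latBox] at hp ⊢
  have : (m : ℝ) ≤ n := by exact_mod_cast h
  exact ⟨hp.1.trans this, hp.2.trans this⟩

/-! ### The competitor field and its admissibility -/

open Classical in
/-- The contribution of a lattice point: a neutral charged cell off `B`; on `B`, a jet which carries
the mass of the cell to infinity, away from the axis `x₀ = 0`. -/
def latField (B : Set (ℤ × ℤ)) (p : ℤ × ℤ) (x : Plane) : Plane :=
  if p ∉ B then cellField (x - latPt p)
  else if 0 ≤ p.1 then jetField (x - latPt p) else -jetField (-(x - latPt p))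

open Classical in
lemma hasSource_latField (B : Set (ℤ × ℤ)) (p : ℤ × ℤ) :
    HasSource (latField B p) (if p ∈ B then 0 else 2 * Real.pi) (latPt p) (latCell p) := by
  by_cases hp : p ∈ B
  · by_cases h0 : 0 ≤ p.1
    · have : latField B p = fun x => jetField (x - latPt p) := by
        funext x; simp [latField, hp, h0]
      rw [if_pos hp, this]
      exact hasSource_jetField.translate (latPt p)
    · have : latField B p = fun x => -jetField (-(x - latPt p)) := by
        funext x; simp only [latField, hp, h0, not_true_eq_false, if_false]
      rw [if_pos hp, this]
      have h := (hasSource_jetField.linearIsometry (LinearIsometryEquiv.neg ℝ)).translate (latPt p)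
      simp only [LinearIsometryEquiv.symm_neg, LinearIsometryEquiv.coe_neg] at h
      refine h.congr_set (Eq.eventuallyEq ?_)
      ext x
      simp [latCell, unitCell, abs_sub_comm]
  · have : latField B p = fun x => cellField (x - latPt p) := by
      funext x; simp [latField, hp]
    rw [if_neg hp, this]
    exact hasSource_cellField.translate (latPt p)

/-- If `x` lies in a jet issuing from `p` with `0 ≤ p.1`, then `0 ≤ p.1 < x 0 ≤ n`, and the height
offset is less than `x 0 - p.1`, so `|p.2| ≤ 2n`; leftward jets are symmetric. This is where sending
jets away from the axis gives local finiteness. -/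
lemma latField_eq_zero (B : Set (ℤ × ℤ)) {n : ℕ} {x : Plane} (h0 : |x 0| ≤ n) (h1 : |x 1| ≤ n)
    {p : ℤ × ℤ} (hp : p ∉ latBox (2 * n + 1)) : latField B p x = 0 := by
  by_contra hne
  have hcell : x - latPt p ∈ unitCell → p ∈ latBox (2 * n + 1) := by
    rintro ⟨c0, c1⟩
    simp only [PiLp.sub_apply, latPt_zero, latPt_one] at c0 c1
    rw [mem_latBox]
    push_cast
    rw [abs_lt] at c0 c1
    rw [abs_le] at h0 h1
    constructor <;> rw [abs_le] <;> constructor <;> linarith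
  have hbox : (|(p.1 : ℝ)| ≤ 2 * n + 1 ∧ |(p.2 : ℝ)| ≤ 2 * n + 1) → False := fun h =>
    hp (mem_latBox.2 (by push_cast; exact h))
  rw [abs_le] at h0 h1
  refine hp ?_
  unfold latField at hne
  split_ifs at hne with hB hs
  · by_contra h
    refine hne (jetField_eq_zero (fun hc => h (hcell hc)) (fun hc => hbox ?_))
    obtain ⟨c0, c1⟩ := hc
    simp only [PiLp.sub_apply, latPt_zero, latPt_one, abs_lt] at c0 c1
    have : (0 : ℝ) ≤ p.1 := by exact_mod_cast hs
    constructor <;> rw [abs_le] <;> constructor <;> linarith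
  · by_contra h
    refine hne ?_
    rw [jetField_eq_zero, neg_zero]
    · intro hc
      refine h (hcell ?_)
      simpa [unitCell, abs_sub_comm] using hc
    · intro hc
      obtain ⟨c0, c1⟩ := hc
      simp only [PiLp.neg_apply, PiLp.sub_apply, latPt_zero, latPt_one, abs_lt] at c0 c1
      have : (p.1 : ℝ) ≤ 0 := by exact_mod_cast (not_le.1 hs).le
      refine hbox ?_
      constructor <;> rw [abs_le] <;> constructor <;> linarith
  · by_contra h
    exact hne (cellField_of_notMem (fun hc => h (hcell hc)))

/-- The competitor field. -/
def totalField (B : Set (ℤ × ℤ)) (x : Plane) : Plane := ∑ᶠ p, latField B p x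

lemma totalField_eq_sum (B : Set (ℤ × ℤ)) {n : ℕ} {x : Plane} (h0 : |x 0| ≤ n) (h1 : |x 1| ≤ n) :
    totalField B x = ∑ p ∈ latBox (2 * n + 1), latField B p x := by
  refine finsum_eq_sum_of_support_subset _ fun p hp => ?_
  by_contra h
  exact hp (latField_eq_zero B h0 h1 h)

lemma totalField_eq_sum_of_mem_closedBall (B : Set (ℤ × ℤ)) {n : ℕ} {x : Plane}
    (hx : x ∈ Metric.closedBall 0 (n : ℝ)) :
    totalField B x = ∑ p ∈ latBox (2 * n + 1), latField B p x := by
  rw [mem_closedBall_zero_iff] at hx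
  exact totalField_eq_sum B ((abs_coord_le_norm x 0).trans hx) ((abs_coord_le_norm x 1).trans hx)

lemma exists_nat_subset_closedBall {K : Set Plane} (hK : IsCompact K) :
    ∃ n : ℕ, K ⊆ Metric.closedBall 0 (n : ℝ) := by
  obtain ⟨r, hr⟩ := hK.isBounded.subset_closedBall 0
  obtain ⟨n, hn⟩ := exists_nat_ge r
  exact ⟨n, hr.trans (Metric.closedBall_subset_closedBall hn)⟩

lemma locallyIntegrable_totalField (B : Set (ℤ × ℤ)) :
    LocallyIntegrable (totalField B) volume := by
  rw [locallyIntegrable_iff]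
  intro K hK
  obtain ⟨n, hn⟩ := exists_nat_subset_closedBall hK
  have h : IntegrableOn (fun x => ∑ p ∈ latBox (2 * n + 1), latField B p x)
      (Metric.closedBall 0 (n : ℝ)) :=
    integrable_finsetSum _ fun p _ =>
      (hasSource_latField B p).locallyIntegrable.integrableOn_isCompact (isCompact_closedBall 0 _)
  exact ((integrableOn_congr_fun (fun x hx => totalField_eq_sum_of_mem_closedBall B hx)
    measurableSet_closedBall).2 h).mono_set hn

/-- A jet is bounded everywhere; a charged cell is bounded on a compact set that avoids its centre,
hence stays at positive distance from it. -/
lemma memLp_latField (B : Set (ℤ × ℤ)) (p : ℤ × ℤ) {K : Set Plane} (hK : IsCompact K)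
    (hpK : p ∉ B → latPt p ∉ K) : MemLp (latField B p) 2 (volume.restrict K) := by
  have : IsFiniteMeasure (volume.restrict K) := ⟨by simpa using hK.measure_lt_top⟩
  suffices h : ∃ M, ∀ x ∈ K, ‖latField B p x‖ ≤ M by
    obtain ⟨M, hM⟩ := h
    refine MemLp.of_bound
      (hasSource_latField B p).locallyIntegrable.aestronglyMeasurable.restrict M ?_
    exact (ae_restrict_iff' hK.measurableSet).2 (Eventually.of_forall hM)
  by_cases hp : p ∈ B
  · refine ⟨32, fun x _ => ?_⟩
    unfold latField
    split_ifs
    · exact norm_jetField_le_const _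
    · rw [norm_neg]; exact norm_jetField_le_const _
  · obtain ⟨δ, hδ, hball⟩ := Metric.isOpen_iff.1 hK.isClosed.isOpen_compl (latPt p) (hpK hp)
    refine ⟨1 / δ + 12, fun x hx => ?_⟩
    have hd : δ ≤ ‖x - latPt p‖ := by
      by_contra! h
      exact hball (by rwa [Metric.mem_ball, dist_eq_norm]) hx
    simp only [latField, hp, not_false_eq_true, if_true]
    refine (norm_cellField_le _).trans ?_
    gcongr

lemma memL2LocOff_totalField {Λ : Set Plane} {B : Set (ℤ × ℤ)} (hB : ∀ p ∉ B, latPt p ∈ Λ) :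
    MemL2LocOff Λ (totalField B) := by
  intro K hK hKΛ
  obtain ⟨n, hn⟩ := exists_nat_subset_closedBall hK
  have h : MemLp (fun x => ∑ p ∈ latBox (2 * n + 1), latField B p x) 2 (volume.restrict K) :=
    memLp_finsetSum _ fun p _ => memLp_latField B p hK fun hp hpK => hKΛ hpK (hB p hp)
  refine h.ae_eq ((ae_restrict_iff' hK.measurableSet).2 (Eventually.of_forall fun x hx => ?_))
  exact (totalField_eq_sum_of_mem_closedBall B (hn hx)).symm

open Classical in
lemma finsum_mem_lattice_diff {A : Set Plane} {f : Plane → ℝ} (s : Finset (ℤ × ℤ))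
    (hf : ∀ p ∉ s, f (latPt p) = 0) :
    ∑ᶠ x ∈ intLattice \ A, f x = ∑ p ∈ s, if p ∈ latPt ⁻¹' A then 0 else f (latPt p) := by
  have himg : intLattice \ A = latPt '' (latPt ⁻¹' A)ᶜ := by
    rw [← preimage_compl, image_preimage_eq_inter_range, range_latPt, sdiff_eq, inter_comm]
  rw [himg, finsum_mem_image latPt_injective.injOn, finsum_mem_def,
    finsum_eq_sum_of_support_subset (s := s)]
  · refine Finset.sum_congr rfl fun p _ => ?_
    by_cases hp : p ∈ latPt ⁻¹' A
    · rw [if_pos hp, indicator_of_notMem (by simpa using hp)]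
    · rw [if_neg hp, indicator_of_mem hp]
  · intro p hp
    by_contra h
    refine hp ?_
    simp [indicator, hf p h]

lemma sum_setIntegral_latCell {φ : Plane → ℝ} (hφ : Integrable φ) {n : ℕ}
    (hs : ∀ x ∉ Metric.closedBall (0 : Plane) n, φ x = 0) {m : ℕ} (hm : n ≤ m) :
    ∑ p ∈ latBox m, ∫ x in latCell p, φ x = ∫ x, φ x := by
  rw [← integral_biUnion_finset _ (fun p _ => measurableSet_latCell p)
    (fun p _ q _ hpq => Set.disjoint_left.2 fun x hp hq => hpq (eq_of_mem_latCell hp hq))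
    (fun p _ => hφ.integrableOn)]
  refine setIntegral_eq_integral_of_ae_compl_eq_zero ?_
  filter_upwards [ae_mem_latCell] with x hx hx'
  refine hs x fun hball => hx' ?_
  rw [mem_closedBall_zero_iff] at hball
  exact mem_biUnion (latBox_mono hm (round_mem_latBox ((abs_coord_le_norm x 0).trans hball)
    ((abs_coord_le_norm x 1).trans hball))) hx

/-- On the support of a test function the field is a finite sum, so the weak equations add. The
charges give the sum over occupied points, and the cell backgrounds tile the plane up to a null set,
which is the density `1`. -/
lemma totalField_mem_admissibleFields (A : Set Plane) :
    totalField (latPt ⁻¹' A) ∈ admissibleFields (intLattice \ A) 1 := by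
  classical
  refine ⟨memL2LocOff_totalField fun p hp => ⟨range_latPt ▸ mem_range_self p, hp⟩,
    locallyIntegrable_totalField _, fun φ hφ hc => ?_⟩
  set B := latPt ⁻¹' A with hB
  obtain ⟨n, hn⟩ := exists_nat_subset_closedBall hc
  have hφ0 : ∀ x ∉ Metric.closedBall (0 : Plane) n, φ x = 0 := fun x hx =>
    image_eq_zero_of_notMem_tsupport fun h => hx (hn h)
  have hd0 : ∀ x ∉ Metric.closedBall (0 : Plane) n, fderiv ℝ φ x = 0 := fun x hx =>
    image_eq_zero_of_notMem_tsupport fun h => hx (hn (tsupport_fderiv_subset ℝ h))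
  have h1 : ∀ x, fderiv ℝ φ x (totalField B x) =
      ∑ p ∈ latBox (2 * n + 1), fderiv ℝ φ x (latField B p x) := by
    intro x
    by_cases hx : x ∈ Metric.closedBall (0 : Plane) n
    · rw [totalField_eq_sum_of_mem_closedBall B hx, map_sum]
    · simp [hd0 x hx]
  have hI := hφ.continuous.integrable_of_hasCompactSupport hc (μ := volume)
  simp only [h1]
  rw [integral_finsetSum _ fun p _ =>
    integrable_fderiv_apply (hasSource_latField B p).locallyIntegrable hφ hc,
    Finset.sum_congr rfl fun p _ => (hasSource_latField B p).weak φ hφ hc,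
    Finset.sum_sub_distrib, ← Finset.mul_sum,
    sum_setIntegral_latCell hI hφ0 (by omega), finsum_mem_lattice_diff (latBox (2 * n + 1)),
    one_mul, mul_sub, Finset.mul_sum]
  · congr 1
    refine Finset.sum_congr rfl fun p _ => ?_
    split_ifs <;> simp
  · intro p hp
    refine hφ0 _ fun h => hp ?_
    rw [mem_closedBall_zero_iff] at h
    refine latBox_mono (by omega : n ≤ 2 * n + 1) (mem_latBox.2 ⟨?_, ?_⟩)
    · simpa using (abs_coord_le_norm (latPt p) 0).trans h
    · simpa using (abs_coord_le_norm (latPt p) 1).trans h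

/-! ### Counting estimates and the discrete potential -/

/-- Summation by parts: a sum of a decreasing function of `d` is controlled by the counting function
of `d`. -/
lemma sum_antitone_le_sqrt {ι : Type*} (s : Finset ι) (d : ι → ℕ) {f F : ℕ → ℝ} {c : ℝ}
    (hf : Antitone f) (hf0 : ∀ k, 0 ≤ f k) (hF : ∀ k, ((s.filter fun i => d i ≤ k).card : ℝ) ≤ F k)
    (h0 : F 0 * f 0 ≤ 2 * c)
    (hstep : ∀ k : ℕ, (F (k + 1) - F k) * f (k + 1) ≤ c / √((k : ℝ) + 2))
    (hc : 0 ≤ c) {K : ℕ} (hK : ∀ i ∈ s, d i ≤ K) :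
    ∑ i ∈ s, f (d i) ≤ 2 * c * √((K : ℝ) + 1) := by
  -- Each value is telescoped down to `f K`; exchanging the sums then makes the counting function
  -- appear.
  have hpart : ∀ K : ℕ, ∀ m ≤ K, f m = f K +
      ∑ k ∈ Finset.range K, if m ≤ k then f k - f (k + 1) else 0 := by
    intro K
    induction K with
    | zero => intro m hm; simp [Nat.le_zero.1 hm]
    | succ K ih =>
      intro m hm
      rw [Finset.sum_range_succ]
      rcases Nat.lt_or_ge K m with h | h
      · have : m = K + 1 := by omega
        subst this
        rw [Finset.sum_eq_zero fun k hk => if_neg (by have := Finset.mem_range.1 hk; omega)]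
        simp
      · rw [if_pos h, ih m h]; ring
  have habel : ∑ i ∈ s, f (d i) ≤ F K * f K + ∑ k ∈ Finset.range K, F k * (f k - f (k + 1)) := by
    rw [Finset.sum_congr rfl fun i hi => hpart K (d i) (hK i hi), Finset.sum_add_distrib,
      Finset.sum_comm]
    refine add_le_add ?_ (Finset.sum_le_sum fun k _ => ?_)
    · rw [Finset.sum_const, nsmul_eq_mul]
      refine mul_le_mul_of_nonneg_right ?_ (hf0 K)
      refine le_trans ?_ (hF K)
      rw [Finset.filter_true_of_mem hK]
    · rw [← Finset.sum_filter, Finset.sum_const, nsmul_eq_mul]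
      exact mul_le_mul_of_nonneg_right (hF k) (sub_nonneg.2 (hf (Nat.le_succ k)))
  refine habel.trans ?_
  clear habel hK
  induction K with
  | zero => simpa using h0
  | succ K ih =>
    rw [Finset.sum_range_succ]
    have h1 := hstep K
    -- The increment of the square root is at least `1 / (2 √(K + 2))`, so the partial sums are
    -- dominated by a telescoping one.
    have h2 : c / √((K : ℝ) + 2) ≤ 2 * c * (√((K : ℝ) + 2) - √((K : ℝ) + 1)) := by
      have p2 : 0 < √((K : ℝ) + 2) := Real.sqrt_pos.2 (by positivity)
      have p1 : 0 < √((K : ℝ) + 1) := Real.sqrt_pos.2 (by positivity)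
      have q2 := Real.sq_sqrt (by positivity : 0 ≤ (K : ℝ) + 2)
      have q1 := Real.sq_sqrt (by positivity : 0 ≤ (K : ℝ) + 1)
      rw [div_le_iff₀ p2]
      have : 1 ≤ 2 * (√((K : ℝ) + 2) - √((K : ℝ) + 1)) * √((K : ℝ) + 2) := by
        nlinarith [sq_nonneg (√((K : ℝ) + 2) - √((K : ℝ) + 1))]
      nlinarith
    push_cast
    rw [show (K : ℝ) + 1 + 1 = K + 2 by ring]
    nlinarith

/-- Chebyshev distance on `ℤ²`. -/
def chebDist (p q : ℤ × ℤ) : ℕ := max (p.1 - q.1).natAbs (p.2 - q.2).natAbs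

lemma chebDist_comm (p q : ℤ × ℤ) : chebDist p q = chebDist q p := by
  unfold chebDist; omega

lemma chebDist_le_of_mem_latBox {m : ℕ} {p q : ℤ × ℤ} (hp : p ∈ latBox m) (hq : q ∈ latBox m) :
    chebDist p q ≤ 2 * m := by
  simp only [latBox, Finset.mem_product, Finset.mem_Icc] at hp hq
  unfold chebDist; omega

lemma card_filter_chebDist_le (s : Finset (ℤ × ℤ)) (q : ℤ × ℤ) (k : ℕ) :
    ((s.filter fun p => chebDist p q ≤ k).card : ℝ) ≤ 4 * ((k : ℝ) + 1) ^ 2 := by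
  have hsub : (s.filter fun p => chebDist p q ≤ k) ⊆
      Finset.Icc (q.1 - k) (q.1 + k) ×ˢ Finset.Icc (q.2 - k) (q.2 + k) := by
    intro p hp
    have := (Finset.mem_filter.1 hp).2
    simp only [Finset.mem_product, Finset.mem_Icc]
    unfold chebDist at this
    omega
  have hcard := Finset.card_le_card hsub
  rw [Finset.card_product, Int.card_Icc, Int.card_Icc,
    show (q.1 + (k : ℤ) + 1 - (q.1 - k)).toNat = 2 * k + 1 by omega,
    show (q.2 + (k : ℤ) + 1 - (q.2 - k)).toNat = 2 * k + 1 by omega] at hcard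
  have : ((s.filter fun p => chebDist p q ≤ k).card : ℝ) ≤ (2 * k + 1) * (2 * k + 1) := by
    exact_mod_cast hcard
  nlinarith

/-- The discrete potential of the part of `B` in `latBox m`. -/
def potential (B : Set (ℤ × ℤ)) [DecidablePred (· ∈ B)] (m : ℕ) (p : ℤ × ℤ) : ℝ :=
  ∑ q ∈ (latBox m).filter (· ∈ B), 1 / ((chebDist q p : ℝ) + 1)

lemma antitone_one_div_sqrt : Antitone fun k : ℕ => 1 / √((k : ℝ) + 1) := by
  intro a b hab
  have : (a : ℝ) ≤ b := by exact_mod_cast hab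
  dsimp only
  gcongr

lemma antitone_one_div_sqrt_cube : Antitone fun k : ℕ => 1 / √((k : ℝ) + 1) ^ 3 := by
  intro a b hab
  have : (a : ℝ) ≤ b := by exact_mod_cast hab
  dsimp only
  gcongr

/-- The Chebyshev distance `d` exceeds the sup-norm distance from `x` to `q` by at most `1/2`. Being
an integer, it satisfies `d + 1 ≤ 3 (1/2 + M)`, with `M` that sup-norm distance, whence `48 = 3 *
16`. -/
lemma norm_latField_le_of_mem {B : Set (ℤ × ℤ)} {p q : ℤ × ℤ} {x : Plane} (hx : x ∈ latCell p) (hq : q ∈ B) :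
    ‖latField B q x‖ ≤ 48 * (1 / ((chebDist q p : ℝ) + 1)) := by
  have h : ‖latField B q x‖ ≤ 16 / (1 / 2 + max |x 0 - q.1| |x 1 - q.2|) := by
    simp only [latField, hq, not_true_eq_false, if_false]
    split_ifs
    · simpa using norm_jetField_le (x - latPt q)
    · simpa [abs_sub_comm] using norm_jetField_le (-(x - latPt q))
  refine h.trans ?_
  rw [mem_latCell] at hx
  have hM : 0 ≤ max |x 0 - q.1| |x 1 - q.2| := le_max_of_le_left (abs_nonneg _)
  have hd : (chebDist q p : ℝ) ≤ 1 / 2 + max |x 0 - q.1| |x 1 - q.2| := by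
    unfold chebDist
    rw [Nat.cast_max, Nat.cast_natAbs, Nat.cast_natAbs]
    push_cast
    refine max_le ?_ ?_
    · have h1 := abs_sub_le (q.1 : ℝ) (x 0) p.1
      rw [abs_sub_comm (q.1 : ℝ) (x 0)] at h1
      linarith [le_max_left |x 0 - q.1| |x 1 - q.2|]
    · have h1 := abs_sub_le (q.2 : ℝ) (x 1) p.2
      rw [abs_sub_comm (q.2 : ℝ) (x 1)] at h1
      linarith [le_max_right |x 0 - q.1| |x 1 - q.2|]
  rw [mul_one_div, div_le_div_iff₀ (by linarith) (by positivity)]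
  rcases Nat.eq_zero_or_pos (chebDist q p) with h0 | h0
  · rw [h0]; norm_num; linarith
  · have : (1 : ℝ) ≤ chebDist q p := by exact_mod_cast h0
    linarith

section
variable {B : Set (ℤ × ℤ)} [DecidablePred (· ∈ B)] {c : ℝ}

/-- Linear counting: each unit of distance adds at most `c` to the counting bound, and two points of
the box are at distance at most `2m`. -/
lemma sum_one_div_sqrt_le (hc : 0 ≤ c) (hB : ∀ (m k : ℕ) (p : ℤ × ℤ),
      ((((latBox m).filter (· ∈ B)).filter fun q => chebDist q p ≤ k).card : ℝ) ≤ c * (k + 1))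
    {m : ℕ} {p : ℤ × ℤ} (hp : p ∈ latBox m) :
    ∑ q ∈ (latBox m).filter (· ∈ B), 1 / √((chebDist q p : ℝ) + 1) ≤
      2 * c * √(2 * m + 1) := by
  have := sum_antitone_le_sqrt ((latBox m).filter (· ∈ B)) (fun q => chebDist q p)
    antitone_one_div_sqrt (fun k => by positivity) (fun k => hB m k p) (c := c)
    (by norm_num; linarith)
    (fun k => by
      push_cast
      rw [show (k : ℝ) + 1 + 1 = k + 2 by ring]
      apply le_of_eq; ring) hc
    (fun q hq => chebDist_le_of_mem_latBox (Finset.mem_filter.1 hq).1 hp)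
  exact_mod_cast this

/-- Planar counting: the bound `4(k+1)²` grows by `4(2k+3) ≤ 8(k+2)`, and multiplying by
`(k+2)^(-3/2)` leaves `8 / √(k+2)`. -/
lemma sum_one_div_sqrt_cube_le {m : ℕ} {q : ℤ × ℤ} (hq : q ∈ latBox m) :
    ∑ p ∈ latBox m, 1 / √((chebDist q p : ℝ) + 1) ^ 3 ≤ 16 * √(2 * m + 1) := by
  have := sum_antitone_le_sqrt (latBox m) (fun p => chebDist q p)
    antitone_one_div_sqrt_cube (fun k => by positivity)
    (fun k => by simpa only [chebDist_comm] using card_filter_chebDist_le (latBox m) q k) (c := 8)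
    (by norm_num)
    (fun k => by
      push_cast
      rw [show (k : ℝ) + 1 + 1 = k + 2 by ring]
      have h1 : 0 < √((k : ℝ) + 2) := Real.sqrt_pos.2 (by positivity)
      have h2 := Real.sq_sqrt (by positivity : 0 ≤ (k : ℝ) + 2)
      rw [mul_one_div, div_le_div_iff₀ (by positivity) h1, pow_succ √((k : ℝ) + 2) 2, h2, ← mul_assoc]
      refine mul_le_mul_of_nonneg_right ?_ h1.le
      nlinarith) (by norm_num)
    (fun p hp => chebDist_le_of_mem_latBox hq hp)
  norm_num at this
  norm_num
  exact_mod_cast this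

/-- A Schur-type estimate. Splitting the squared kernel into exponents `1/2` and `3/2` makes both
sums grow like `√m`; the number of vacancies in the box supplies the remaining factor `m`. -/
lemma sum_potential_sq_le (hc : 0 ≤ c) (hB : ∀ (m k : ℕ) (p : ℤ × ℤ),
      ((((latBox m).filter (· ∈ B)).filter fun q => chebDist q p ≤ k).card : ℝ) ≤ c * (k + 1))
    (m : ℕ) :
    ∑ p ∈ latBox m, potential B m p ^ 2 ≤ 32 * c ^ 2 * (2 * m + 1) * (m + 1) := by
  have h1 : ∀ p ∈ latBox m, potential B m p ^ 2 ≤ (2 * c * √(2 * m + 1)) *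
      ∑ q ∈ (latBox m).filter (· ∈ B), 1 / √((chebDist q p : ℝ) + 1) ^ 3 := by
    intro p hp
    refine (Finset.sum_sq_le_sum_mul_sum_of_sq_le_mul _
      (f := fun q => 1 / √((chebDist q p : ℝ) + 1))
      (g := fun q => 1 / √((chebDist q p : ℝ) + 1) ^ 3)
      (fun _ _ => by positivity) (fun _ _ => by positivity) (fun q _ => ?_)).trans
      (mul_le_mul_of_nonneg_right (sum_one_div_sqrt_le hc hB hp)
        (Finset.sum_nonneg fun _ _ => by positivity))
    have h2 := Real.sq_sqrt (by positivity : 0 ≤ (chebDist q p : ℝ) + 1)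
    have h3 : 0 < √((chebDist q p : ℝ) + 1) := Real.sqrt_pos.2 (by positivity)
    refine le_of_eq ?_
    rw [div_mul_div_comm, div_pow, one_pow, one_mul]
    nth_rewrite 1 [← h2]
    ring
  refine (Finset.sum_le_sum h1).trans ?_
  rw [← Finset.mul_sum, Finset.sum_comm]
  have h2 : ∑ q ∈ (latBox m).filter (· ∈ B),
      ∑ p ∈ latBox m, 1 / √((chebDist q p : ℝ) + 1) ^ 3 ≤ c * (m + 1) * (16 * √(2 * m + 1)) := by
    refine (Finset.sum_le_card_nsmul _ _ _ fun q hq =>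
      sum_one_div_sqrt_cube_le (Finset.mem_filter.1 hq).1).trans ?_
    rw [nsmul_eq_mul]
    refine mul_le_mul_of_nonneg_right ?_ (by positivity)
    -- The whole box is the Chebyshev ball of radius `m` about the origin, so the counting
    -- hypothesis bounds all its vacancies.
    refine le_trans (Nat.cast_le.2 (Finset.card_le_card fun q hq => ?_)) (hB m m (0, 0))
    refine Finset.mem_filter.2 ⟨hq, ?_⟩
    have := (Finset.mem_filter.1 hq).1
    simp only [latBox, Finset.mem_product, Finset.mem_Icc] at this
    unfold chebDist; omega
  refine (mul_le_mul_of_nonneg_left h2 (by positivity)).trans (le_of_eq ?_)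
  have h3 := Real.sq_sqrt (by positivity : 0 ≤ 2 * (m : ℝ) + 1)
  linear_combination (32 * c ^ 2 * (m + 1)) * h3

/-- Pointwise bound on the competitor in the cell of `p`. -/
lemma norm_totalField_le {n : ℕ} {x : Plane} (h0 : |x 0| ≤ n) (h1 : |x 1| ≤ n) {p : ℤ × ℤ}
    (hx : x ∈ latCell p) :
    ‖totalField B x‖ ≤ (if p ∈ B then 0 else 1 / ‖x - latPt p‖) +
      (12 + 48 * potential B (2 * n + 1) p) := by
  rw [totalField_eq_sum B h0 h1]
  refine (norm_sum_le _ _).trans ?_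
  rw [← Finset.sum_filter_add_sum_filter_not (latBox (2 * n + 1)) (· ∈ B)]
  have hB : ∑ q ∈ (latBox (2 * n + 1)).filter (· ∈ B), ‖latField B q x‖ ≤
      48 * potential B (2 * n + 1) p := by
    rw [potential, Finset.mul_sum]
    exact Finset.sum_le_sum fun q hq => norm_latField_le_of_mem hx (Finset.mem_filter.1 hq).2
  -- The open cells are disjoint and `x` lies in that of `p`, so no other charged cell contributes.
  have hL : ∑ q ∈ (latBox (2 * n + 1)).filter (¬ · ∈ B), ‖latField B q x‖ ≤
      (if p ∈ B then 0 else 1 / ‖x - latPt p‖) + 12 := by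
    have hz : ∀ q ∈ (latBox (2 * n + 1)).filter (¬ · ∈ B), q ≠ p → ‖latField B q x‖ = 0 := by
      intro q hq hqp
      simp only [latField, (Finset.mem_filter.1 hq).2, not_false_eq_true, if_true]
      rw [cellField_of_notMem fun h => hqp (eq_of_mem_latCell h hx), norm_zero]
    have hnn : 0 ≤ (if p ∈ B then 0 else 1 / ‖x - latPt p‖) + 12 := by
      split_ifs <;> positivity
    by_cases hp : p ∈ (latBox (2 * n + 1)).filter (¬ · ∈ B)
    · rw [Finset.sum_eq_single_of_mem p hp hz, if_neg (Finset.mem_filter.1 hp).2]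
      simp only [latField, (Finset.mem_filter.1 hp).2, not_false_eq_true, if_true]
      exact norm_cellField_le _
    · rw [Finset.sum_eq_zero fun q hq => hz q hq fun h => hp (h ▸ hq)]
      exact hnn
  linarith

end

/-! ### Energy of the competitor against a cutoff -/

/-- Polar coordinates reduce this to the integral of `a / y + b + c * y` over `(η, 1)`. With outer
radius `1`, the `a` term gives exactly `-log η` with no additive constant. -/
lemma lintegral_annulus_le (p : Plane) {a b c η : ℝ} (ha : 0 ≤ a) (hb : 0 ≤ b) (hc : 0 ≤ c)
    (hη : 0 < η) (hη1 : η < 1) :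
    ∫⁻ x in Metric.ball p 1 \ Metric.ball p η,
      ENNReal.ofReal (a / ‖x - p‖ ^ 2 + b / ‖x - p‖ + c) ≤
      ENNReal.ofReal (2 * Real.pi * (a * -Real.log η + b + c / 2)) := by
  set h : ℝ → ℝ := (Ico η 1).indicator fun y => a / y ^ 2 + b / y + c with hh
  have hh0 : ∀ y, 0 ≤ h y := fun y => indicator_nonneg (fun y hy => by
    have : 0 < y := hη.trans_le hy.1
    positivity) y
  have hdim : Module.finrank ℝ Plane = 2 := by simp
  have hcont : ContinuousOn (fun y : ℝ => a / y + b + c * y) (Icc η 1) := by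
    refine ContinuousOn.add (ContinuousOn.add (ContinuousOn.div continuousOn_const
      continuousOn_id fun y hy => (hη.trans_le hy.1).ne') continuousOn_const) (by fun_prop)
  have hprod : (fun y : ℝ => y ^ (2 - 1) • h y) =
      (Ico η 1).indicator fun y => a / y + b + c * y := by
    funext y
    by_cases hy : y ∈ Ico η 1
    · have : y ≠ 0 := (hη.trans_le hy.1).ne'
      simp only [hh, indicator_of_mem hy, smul_eq_mul]
      field_simp
      ring
    · simp [hh, indicator_of_notMem hy]
  have hint1 : IntegrableOn (fun y : ℝ => a / y + b + c * y) (Ico η 1) :=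
    (hcont.integrableOn_compact isCompact_Icc).mono_set Ico_subset_Icc_self
  have hint : Integrable (fun x : Plane => h ‖x‖) := by
    rw [integrable_fun_norm_addHaar volume, hdim, hprod]
    exact ((integrable_indicator_iff measurableSet_Ico).2 hint1).integrableOn
  have hval : ∫ x : Plane, h ‖x‖ ≤ 2 * Real.pi * (a * -Real.log η + b + c / 2) := by
    have hsub : Ico η 1 ∩ Ioi 0 = Ico η 1 := inter_eq_left.2 fun y hy => hη.trans_le hy.1
    have hball : (volume : Measure Plane).real (Metric.ball 0 1) = Real.pi := by
      rw [Measure.real, EuclideanSpace.volume_ball_fin_two]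
      simp [Real.pi_pos.le]
    rw [integral_fun_norm_addHaar volume, hdim, hprod, hball,
      setIntegral_indicator measurableSet_Ico, inter_comm, hsub,
      integral_Ico_eq_integral_Ioc, ← intervalIntegral.integral_of_le hη1.le]
    have h1 : ∫ y in η..1, (a / y + b + c * y) =
        a * -Real.log η + b * (1 - η) + c * ((1 - η ^ 2) / 2) := by
      have hne : ∀ y ∈ uIcc η 1, y ≠ 0 := by
        intro y hy
        rw [uIcc_of_le hη1.le] at hy
        exact (hη.trans_le hy.1).ne'
      have hF : ∀ y ∈ uIcc η 1, HasDerivAt (fun y => a * Real.log y + b * y + c * (y ^ 2 / 2))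
          (a / y + b + c * y) y := by
        intro y hy
        have := (((Real.hasDerivAt_log (hne y hy)).const_mul a).fun_add
          ((hasDerivAt_id y).const_mul b)).fun_add
          (((hasDerivAt_pow 2 y).div_const 2).const_mul c)
        convert! this using 1
        simp
        ring
      rw [intervalIntegral.integral_eq_sub_of_hasDerivAt hF]
      · simp; ring
      · refine ContinuousOn.intervalIntegrable ?_
        rwa [uIcc_of_le hη1.le]
    rw [h1, nsmul_eq_mul, smul_eq_mul]
    push_cast
    rw [mul_assoc]
    refine mul_le_mul_of_nonneg_left (mul_le_mul_of_nonneg_left ?_ Real.pi_pos.le) (by norm_num)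
    nlinarith [mul_nonneg hb hη.le, mul_nonneg hc (sq_nonneg η)]
  calc ∫⁻ x in Metric.ball p 1 \ Metric.ball p η,
        ENNReal.ofReal (a / ‖x - p‖ ^ 2 + b / ‖x - p‖ + c)
      = ∫⁻ x in Metric.ball p 1 \ Metric.ball p η, ENNReal.ofReal (h ‖x - p‖) := by
        refine setLIntegral_congr_fun (measurableSet_ball.diff measurableSet_ball) fun x hx => ?_
        have : ‖x - p‖ ∈ Ico η 1 := by
          simp only [Set.mem_sdiff, Metric.mem_ball, dist_eq_norm, not_lt] at hx
          exact ⟨hx.2, hx.1⟩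
        simp only [hh, indicator_of_mem this]
    _ ≤ ∫⁻ x, ENNReal.ofReal (h ‖x - p‖) := setLIntegral_le_lintegral _ _
    _ = ∫⁻ x, ENNReal.ofReal (h ‖x‖) :=
        lintegral_sub_right_eq_self (fun x => ENNReal.ofReal (h ‖x‖)) p
    _ = ENNReal.ofReal (∫ x : Plane, h ‖x‖) :=
        (ofReal_integral_eq_lintegral_ofReal hint (Eventually.of_forall fun x => hh0 _)).symm
    _ ≤ _ := ENNReal.ofReal_le_ofReal hval

lemma latCell_subset_ball (p : ℤ × ℤ) : latCell p ⊆ Metric.ball (latPt p) 1 := by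
  intro x hx
  rw [mem_latCell] at hx
  rw [Metric.mem_ball, dist_eq_norm]
  refine (norm_le_abs_add_abs _).trans_lt ?_
  simp only [PiLp.sub_apply, latPt_zero, latPt_one]
  linarith

section
variable {χ : Plane → ℝ} {C R : ℝ}

lemma cutoff_lipschitz (hs : ContDiff ℝ (⊤ : ℕ∞) χ) (hd : ∀ x, ‖fderiv ℝ χ x‖ ≤ C) (x y : Plane) :
    |χ x - χ y| ≤ C * ‖x - y‖ := by
  have := Convex.norm_image_sub_le_of_norm_fderiv_le (𝕜 := ℝ) (f := χ) (s := univ) (x := y) (y := x)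
    (fun z _ => hs.differentiable (by simp) z) (fun z _ => hd z) convex_univ (mem_univ _)
    (mem_univ _)
  simpa using this

/-- A cutoff family has no upper bound by definition; one follows from the gradient bound, because
every point of `B_R` is within distance `1` of `B_{R-1}`, where the value is `1`. -/
lemma cutoff_le (hR : 1 < R) (hs : ContDiff ℝ (⊤ : ℕ∞) χ) (hd : ∀ x, ‖fderiv ℝ χ x‖ ≤ C)
    (h1 : ∀ x ∈ Metric.ball (0 : Plane) (R - 1), χ x = 1)
    (h0 : ∀ x ∉ Metric.ball (0 : Plane) R, χ x = 0) (x : Plane) : χ x ≤ 1 + C := by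
  have hC : 0 ≤ C := (norm_nonneg _).trans (hd 0)
  by_cases hx : x ∈ Metric.ball (0 : Plane) R
  swap
  · rw [h0 x hx]; linarith
  have hR0 : 0 < R := by linarith
  rw [mem_ball_zero_iff] at hx
  -- Radial contraction moves `x` by `‖x‖ / R ≤ 1`.
  set y := ((R - 1) / R) • x with hy
  have hc0 : 0 < (R - 1) / R := div_pos (by linarith) hR0
  have hyb : y ∈ Metric.ball (0 : Plane) (R - 1) := by
    rw [mem_ball_zero_iff, hy, norm_smul, Real.norm_of_nonneg hc0.le, div_mul_eq_mul_div,
      div_lt_iff₀ hR0]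
    exact mul_lt_mul_of_pos_left hx (by linarith)
  have hxy : ‖x - y‖ ≤ 1 := by
    have : x - y = (1 / R) • x := by
      rw [hy]
      nth_rewrite 1 [← one_smul ℝ x]
      rw [← sub_smul]
      congr 1
      field_simp
      ring
    rw [this, norm_smul, Real.norm_of_nonneg (by positivity), one_div_mul_eq_div,
      div_le_one hR0]
    exact hx.le
  have h2 := cutoff_lipschitz hs hd x y
  rw [h1 y hyb] at h2
  have h3 := (le_abs_self _).trans h2
  nlinarith

variable {B : Set (ℤ × ℤ)} [DecidablePred (· ∈ B)] {Λ : Set Plane}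

/-- Only the `r⁻²` term needs the sharp coefficient `a`, the cutoff at the lattice point; the
Lipschitz error `C * r` lowers the singularity to the integrable `1 / r`. -/
lemma energy_density_le {r M t a : ℝ} (hM : 0 ≤ M) (hC : 0 ≤ C) (hr : 0 < r)
    (ht : t ≤ 1 + C) (hta : t ≤ a + C * r) (ht0 : 0 ≤ t) {v : ℝ} (hv0 : 0 ≤ v)
    (hv : v ≤ 1 / r + M) :
    t * v ^ 2 ≤ a / r ^ 2 + (C + (1 + C) * (1 + M ^ 2)) / r + (1 + C) * M ^ 2 := by
  have h1 : v ^ 2 ≤ (1 / r + M) ^ 2 := pow_le_pow_left₀ hv0 hv 2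
  have h2 : t * (1 / r) ^ 2 ≤ a / r ^ 2 + C / r := by
    have : (a + C * r) * (1 / r) ^ 2 = a / r ^ 2 + C / r := by field_simp
    rw [← this]
    exact mul_le_mul_of_nonneg_right hta (sq_nonneg _)
  have h3 : t * (2 * (1 / r) * M) ≤ (1 + C) * (1 + M ^ 2) / r := by
    rw [show t * (2 * (1 / r) * M) = t * (2 * M) / r by ring]
    gcongr
    nlinarith [sq_nonneg (M - 1)]
  have h4 : t * M ^ 2 ≤ (1 + C) * M ^ 2 := mul_le_mul_of_nonneg_right ht (sq_nonneg M)
  calc t * v ^ 2 ≤ t * (1 / r + M) ^ 2 := mul_le_mul_of_nonneg_left h1 ht0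
    _ = t * (1 / r) ^ 2 + t * (2 * (1 / r) * M) + t * M ^ 2 := by ring
    _ ≤ (a / r ^ 2 + C / r) + (1 + C) * (1 + M ^ 2) / r + (1 + C) * M ^ 2 := by linarith
    _ = _ := by ring

lemma potential_nonneg (m : ℕ) (p : ℤ × ℤ) : 0 ≤ potential B m p :=
  Finset.sum_nonneg fun _ _ => by positivity

/-- A vacant cell has a bounded integrand. An occupied cell, minus its small ball, lies in an
annulus of outer radius `1`, and the logarithm comes out with the exact coefficient `2π χ(p)` needed
for cancellation. -/
lemma lintegral_latCell_le (hR : 1 < R) (hs : ContDiff ℝ (⊤ : ℕ∞) χ) (hnn : ∀ x, 0 ≤ χ x)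
    (hd : ∀ x, ‖fderiv ℝ χ x‖ ≤ C) (h1 : ∀ x ∈ Metric.ball (0 : Plane) (R - 1), χ x = 1)
    (h0 : ∀ x ∉ Metric.ball (0 : Plane) R, χ x = 0) (hΛ : ∀ p ∉ B, latPt p ∈ Λ) {n : ℕ}
    (hn : R ≤ n) {η : ℝ} (hη : 0 < η) (hη1 : η < 1) (p : ℤ × ℤ) :
    ∫⁻ x in latCell p, ENNReal.ofReal (χ x * ‖totalField B x‖ ^ 2)
        ∂(volume.restrict (⋃ q ∈ Λ, Metric.ball q η)ᶜ) ≤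
      ENNReal.ofReal ((if p ∈ B then 0 else 2 * Real.pi * (χ (latPt p) * -Real.log η)) +
        4 * Real.pi * (1 + C) * (1 + (12 + 48 * potential B (2 * n + 1) p) ^ 2)) := by
  have hC : 0 ≤ C := (norm_nonneg _).trans (hd 0)
  have hpi := Real.pi_pos
  set M := 12 + 48 * potential B (2 * n + 1) p with hMdef
  have hM : 0 ≤ M := by have := potential_nonneg (B := B) (2 * n + 1) p; linarith
  have hχ := cutoff_le hR hs hd h1 h0
  have hbound : ∀ x ∈ latCell p, χ x ≠ 0 → ‖totalField B x‖ ≤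
      (if p ∈ B then 0 else 1 / ‖x - latPt p‖) + M := by
    intro x hx hne
    have hxR : ‖x‖ < R := by
      by_contra h
      exact hne (h0 x (by rwa [mem_ball_zero_iff]))
    exact norm_totalField_le ((abs_coord_le_norm x 0).trans (hxR.le.trans hn))
      ((abs_coord_le_norm x 1).trans (hxR.le.trans hn)) hx
  rw [Measure.restrict_restrict (measurableSet_latCell p)]
  by_cases hp : p ∈ B
  · simp only [hp, if_true, zero_add] at hbound ⊢
    calc _ ≤ ∫⁻ x in latCell p, ENNReal.ofReal (χ x * ‖totalField B x‖ ^ 2) :=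
          lintegral_mono_set inter_subset_left
      _ ≤ ∫⁻ _ in latCell p, ENNReal.ofReal ((1 + C) * M ^ 2) := by
          refine setLIntegral_mono' (measurableSet_latCell p) fun x hx =>
            ENNReal.ofReal_le_ofReal ?_
          by_cases hne : χ x = 0
          · rw [hne, zero_mul]; positivity
          · exact mul_le_mul (hχ x) (pow_le_pow_left₀ (norm_nonneg _) (hbound x hx hne) 2)
              (by positivity) (by positivity)
      _ = ENNReal.ofReal ((1 + C) * M ^ 2) * volume (latCell p) := setLIntegral_const _ _
      _ ≤ ENNReal.ofReal ((1 + C) * M ^ 2) * ENNReal.ofReal Real.pi := by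
          gcongr
          refine (measure_mono (latCell_subset_ball p)).trans (le_of_eq ?_)
          rw [EuclideanSpace.volume_ball_fin_two]
          simp
      _ = ENNReal.ofReal ((1 + C) * M ^ 2 * Real.pi) := (ENNReal.ofReal_mul (by positivity)).symm
      _ ≤ _ := by
          refine ENNReal.ofReal_le_ofReal ?_
          have : 0 ≤ (1 + C) * Real.pi := by positivity
          nlinarith [mul_nonneg this (sq_nonneg M)]
  · simp only [hp, if_false] at hbound ⊢
    have hsub : latCell p ∩ (⋃ q ∈ Λ, Metric.ball q η)ᶜ ⊆
        Metric.ball (latPt p) 1 \ Metric.ball (latPt p) η := fun x hx =>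
      ⟨latCell_subset_ball p hx.1, fun h => hx.2 (mem_biUnion (hΛ p hp) h)⟩
    have hm : MeasurableSet (latCell p ∩ (⋃ q ∈ Λ, Metric.ball q η)ᶜ) :=
      (measurableSet_latCell p).inter
        (isOpen_biUnion fun q _ => Metric.isOpen_ball).measurableSet.compl
    calc _ ≤ ∫⁻ x in latCell p ∩ (⋃ q ∈ Λ, Metric.ball q η)ᶜ, ENNReal.ofReal
          (χ (latPt p) / ‖x - latPt p‖ ^ 2 + (C + (1 + C) * (1 + M ^ 2)) / ‖x - latPt p‖ +
            (1 + C) * M ^ 2) := by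
          refine setLIntegral_mono' hm fun x hx => ENNReal.ofReal_le_ofReal ?_
          have hr : 0 < ‖x - latPt p‖ := by
            have := (hsub hx).2
            rw [Metric.mem_ball, dist_eq_norm, not_lt] at this
            linarith
          by_cases hne : χ x = 0
          · have := hnn (latPt p)
            rw [hne, zero_mul]; positivity
          · refine energy_density_le hM hC hr (hχ x) ?_ (hnn x) (norm_nonneg _) (hbound x hx.1 hne)
            have := (le_abs_self _).trans (cutoff_lipschitz hs hd x (latPt p))
            linarith
      _ ≤ ∫⁻ x in Metric.ball (latPt p) 1 \ Metric.ball (latPt p) η, ENNReal.ofReal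
          (χ (latPt p) / ‖x - latPt p‖ ^ 2 + (C + (1 + C) * (1 + M ^ 2)) / ‖x - latPt p‖ +
            (1 + C) * M ^ 2) := lintegral_mono_set hsub
      _ ≤ _ := lintegral_annulus_le _ (hnn _) (by positivity) (by positivity) hη hη1
      _ ≤ _ := by
          refine ENNReal.ofReal_le_ofReal ?_
          have h5 : C + (1 + C) * (1 + M ^ 2) + (1 + C) * M ^ 2 / 2 ≤
              2 * ((1 + C) * (1 + M ^ 2)) := by nlinarith [mul_nonneg hC (sq_nonneg M), sq_nonneg M]
          nlinarith [mul_le_mul_of_nonneg_left h5 (by positivity : 0 ≤ 2 * Real.pi)]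

lemma lintegral_compl_balls_le (hR : 1 < R) (hs : ContDiff ℝ (⊤ : ℕ∞) χ) (hnn : ∀ x, 0 ≤ χ x)
    (hd : ∀ x, ‖fderiv ℝ χ x‖ ≤ C) (h1 : ∀ x ∈ Metric.ball (0 : Plane) (R - 1), χ x = 1)
    (h0 : ∀ x ∉ Metric.ball (0 : Plane) R, χ x = 0) (hΛ : ∀ p ∉ B, latPt p ∈ Λ) {n : ℕ}
    (hn : R ≤ n) {η : ℝ} (hη : 0 < η) (hη1 : η < 1) :
    ∫⁻ x in (⋃ q ∈ Λ, Metric.ball q η)ᶜ, ENNReal.ofReal (χ x * ‖totalField B x‖ ^ 2) ≤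
      ENNReal.ofReal (∑ p ∈ latBox (2 * n + 1),
        ((if p ∈ B then 0 else 2 * Real.pi * (χ (latPt p) * -Real.log η)) +
        4 * Real.pi * (1 + C) * (1 + (12 + 48 * potential B (2 * n + 1) p) ^ 2))) := by
  have hC : 0 ≤ C := (norm_nonneg _).trans (hd 0)
  have hlog : 0 ≤ -Real.log η := neg_nonneg.2 (Real.log_nonpos hη.le hη1.le)
  rw [ENNReal.ofReal_sum_of_nonneg]
  swap
  · intro p _
    have := hnn (latPt p)
    have := Real.pi_pos
    refine add_nonneg ?_ (by positivity)
    split_ifs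
    · exact le_rfl
    · positivity
  refine le_trans ?_ (Finset.sum_le_sum fun p _ =>
    lintegral_latCell_le hR hs hnn hd h1 h0 hΛ hn hη hη1 p)
  rw [← lintegral_biUnion_finset (fun p _ q _ hpq => Set.disjoint_left.2 fun x hp hq =>
    hpq (eq_of_mem_latCell hp hq)) (fun p _ => measurableSet_latCell p),
    ← lintegral_indicator (Finset.measurableSet_biUnion _ fun p _ => measurableSet_latCell p)]
  refine lintegral_mono_ae ?_
  filter_upwards [ae_restrict_of_ae ae_mem_latCell] with x hx
  by_cases hxR : x ∈ Metric.ball (0 : Plane) R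
  · rw [indicator_of_mem]
    rw [mem_ball_zero_iff] at hxR
    exact mem_biUnion (latBox_mono (by omega : n ≤ 2 * n + 1)
      (round_mem_latBox ((abs_coord_le_norm x 0).trans (hxR.le.trans hn))
        ((abs_coord_le_norm x 1).trans (hxR.le.trans hn)))) hx
  · rw [h0 x hxR, zero_mul, ENNReal.ofReal_zero]
    exact zero_le

end

/-! ### Quadratic growth in the radius and conclusion -/

lemma card_latBox (m : ℕ) : ((latBox m).card : ℝ) = (2 * m + 1) ^ 2 := by
  rw [latBox, Finset.card_product, Int.card_Icc,
    show ((m : ℤ) + 1 - -m).toNat = 2 * m + 1 by omega]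
  push_cast
  ring

section
variable {B : Set (ℤ × ℤ)} [DecidablePred (· ∈ B)] {c : ℝ}

lemma sum_one_add_sq_potential_le (hc : 0 ≤ c) (hB : ∀ (m k : ℕ) (p : ℤ × ℤ),
      ((((latBox m).filter (· ∈ B)).filter fun q => chebDist q p ≤ k).card : ℝ) ≤ c * (k + 1))
    {R : ℝ} (hR : 1 < R) {n : ℕ} (hn : n ≤ R + 1) :
    ∑ p ∈ latBox (2 * n + 1), (1 + (12 + 48 * potential B (2 * n + 1) p) ^ 2) ≤
      (289 * 11 ^ 2 + 4608 * (32 * c ^ 2 * 11 * 6)) * R ^ 2 := by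
  set m := 2 * n + 1 with hm
  -- Since `R > 1`, `2(R + 1) + 1 ≤ 5R`; the factors `11` and `6` below bound `2m + 1` and `m + 1`
  -- in the same way.
  have hmR : (m : ℝ) ≤ 5 * R := by rw [hm]; push_cast; linarith
  have hm0 : (0 : ℝ) ≤ m := Nat.cast_nonneg m
  calc _ ≤ ∑ p ∈ latBox m, (289 + 4608 * potential B m p ^ 2) :=
        -- From `(a + b)² ≤ 2a² + 2b²`: `289 = 1 + 2 * 12²` and `4608 = 2 * 48²`.
        Finset.sum_le_sum fun p _ => by nlinarith [sq_nonneg (12 - 48 * potential B m p)]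
    _ = 289 * (2 * m + 1) ^ 2 + 4608 * ∑ p ∈ latBox m, potential B m p ^ 2 := by
        rw [Finset.sum_add_distrib, Finset.sum_const, nsmul_eq_mul, card_latBox, Finset.mul_sum]
        ring
    _ ≤ 289 * (2 * m + 1) ^ 2 + 4608 * (32 * c ^ 2 * (2 * m + 1) * (m + 1)) := by
        gcongr
        exact sum_potential_sq_le hc hB m
    _ ≤ 289 * (11 * R) ^ 2 + 4608 * (32 * c ^ 2 * (11 * R) * (6 * R)) := by
        gcongr <;> linarith
    _ = _ := by ring

end

/-- The truncated energies of the competitor grow at most like the area. -/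
lemma cutoffEnergy_totalField_le {A : Set Plane} {χ : Plane → ℝ} {C c R : ℝ} (hc : 0 ≤ c)
    {B : Set (ℤ × ℤ)} (hBA : latPt ⁻¹' A = B) [DecidablePred (· ∈ B)]
    (hB : ∀ (m k : ℕ) (p : ℤ × ℤ),
      ((((latBox m).filter (· ∈ B)).filter fun q => chebDist q p ≤ k).card : ℝ) ≤ c * (k + 1))
    (hR : 1 < R) (hs : ContDiff ℝ (⊤ : ℕ∞) χ) (hnn : ∀ x, 0 ≤ χ x)
    (hd : ∀ x, ‖fderiv ℝ χ x‖ ≤ C) (h1 : ∀ x ∈ Metric.ball (0 : Plane) (R - 1), χ x = 1)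
    (h0 : ∀ x ∉ Metric.ball (0 : Plane) R, χ x = 0) :
    cutoffEnergy (intLattice \ A) (totalField B) χ ≤
      ((2 * Real.pi * (1 + C) *
        ((289 * 11 ^ 2 + 4608 * (32 * c ^ 2 * 11 * 6)) * R ^ 2) : ℝ) : EReal) := by
  have hC : 0 ≤ C := (norm_nonneg _).trans (hd 0)
  have hpi := Real.pi_pos
  set n := ⌈R⌉₊ with hndef
  have hn : R ≤ n := Nat.le_ceil R
  have hn' : (n : ℝ) ≤ R + 1 := (Nat.ceil_lt_add_one (by linarith)).le
  have hsum := sum_one_add_sq_potential_le hc hB hR hn'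
  have hχ0 : ∀ p ∉ latBox (2 * n + 1), χ (latPt p) = 0 := by
    intro p hp
    refine h0 _ fun h => hp ?_
    rw [mem_ball_zero_iff] at h
    refine latBox_mono (by omega : n ≤ 2 * n + 1) (mem_latBox.2 ⟨?_, ?_⟩)
    · simpa using (abs_coord_le_norm (latPt p) 0).trans (h.le.trans hn)
    · simpa using (abs_coord_le_norm (latPt p) 1).trans (h.le.trans hn)
  have hfin : ∑ᶠ x ∈ intLattice \ A, χ x =
      ∑ p ∈ latBox (2 * n + 1), if p ∈ B then 0 else χ (latPt p) := by
    rw [finsum_mem_lattice_diff _ hχ0, hBA]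
    exact Finset.sum_congr rfl fun p _ => by congr
  refine limsup_le_of_le (h := ?_)
  filter_upwards [Ioo_mem_nhdsGT (zero_lt_one' ℝ)] with η hη
  have hI := lintegral_compl_balls_le (B := B) (Λ := intLattice \ A) hR hs hnn hd h1 h0
    (fun p hp => ⟨range_latPt ▸ mem_range_self p, fun h => hp (hBA ▸ h)⟩) hn hη.1 hη.2
  rw [Finset.sum_add_distrib, ← Finset.mul_sum] at hI
  -- Half of this sum is exactly the negative of the renormalising term, so the bound obtained is
  -- uniform in `η`.
  have hlog : ∑ p ∈ latBox (2 * n + 1),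
      (if p ∈ B then 0 else 2 * Real.pi * (χ (latPt p) * -Real.log η)) =
      -(2 * (Real.pi * Real.log η * ∑ᶠ x ∈ intLattice \ A, χ x)) := by
    rw [hfin, Finset.mul_sum, Finset.mul_sum, ← Finset.sum_neg_distrib]
    refine Finset.sum_congr rfl fun p _ => ?_
    split_ifs <;> ring
  rw [hlog] at hI
  set s := Real.pi * Real.log η * ∑ᶠ x ∈ intLattice \ A, χ x with hsdef
  have hs0 : s ≤ 0 := by
    refine mul_nonpos_of_nonpos_of_nonneg (mul_nonpos_of_nonneg_of_nonpos hpi.le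
      (Real.log_nonpos hη.1.le hη.2.le)) ?_
    exact finsum_nonneg fun x => finsum_nonneg fun _ => hnn x
  set T := 2 * Real.pi * (1 + C) *
    ((289 * 11 ^ 2 + 4608 * (32 * c ^ 2 * 11 * 6)) * R ^ 2) with hT
  have hT0 : 0 ≤ T := by positivity
  have hI' : (∫⁻ x in (⋃ q ∈ intLattice \ A, Metric.ball q η)ᶜ,
      ENNReal.ofReal (χ x * ‖totalField B x‖ ^ 2)) / 2 ≤ ENNReal.ofReal (-s + T) := by
    have h2 : ENNReal.ofReal (-s + T) = ENNReal.ofReal (2 * (-s + T)) / 2 := by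
      rw [ENNReal.ofReal_mul (by norm_num), ENNReal.ofReal_ofNat, mul_comm,
        ENNReal.mul_div_cancel_right (by norm_num) (by norm_num)]
    rw [h2]
    refine ENNReal.div_le_div_right (hI.trans (ENNReal.ofReal_le_ofReal ?_)) 2
    have := mul_le_mul_of_nonneg_left hsum (by positivity : 0 ≤ 4 * Real.pi * (1 + C))
    rw [hT]
    linarith
  calc _ ≤ ((ENNReal.ofReal (-s + T) : ENNReal) : EReal) + (s : EReal) :=
        add_le_add (EReal.coe_ennreal_le_coe_ennreal_iff.2 hI') le_rfl
    _ = ((-s + T + s : ℝ) : EReal) := by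
        rw [EReal.coe_ennreal_ofReal, max_eq_left (by linarith), ← EReal.coe_add]
    _ = (T : EReal) := by congr 1; ring

/-- A Chebyshev ball of radius `k` lies in the open Euclidean ball of radius `2(k + 1)`, which
exceeds `1` even for `k = 0`, as the counting hypothesis requires. -/
lemma card_filter_chebDist_le_of_encard {A : Set Plane} {C : ℝ} (hC : 0 ≤ C)
    (hcount : ∀ x : Plane, ∀ R : ℝ, 1 < R →
      ((A ∩ Metric.ball x R).encard : ENNReal) ≤ ENNReal.ofReal (C * R))
    [DecidablePred (· ∈ latPt ⁻¹' A)] (s : Finset (ℤ × ℤ)) (k : ℕ) (p : ℤ × ℤ) :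
    (((s.filter (· ∈ latPt ⁻¹' A)).filter fun q => chebDist q p ≤ k).card : ℝ) ≤
      2 * C * (k + 1) := by
  set t := (s.filter (· ∈ latPt ⁻¹' A)).filter fun q => chebDist q p ≤ k with ht
  have hsub : latPt '' t ⊆ A ∩ Metric.ball (latPt p) (2 * (k + 1)) := by
    rintro _ ⟨q, hq, rfl⟩
    obtain ⟨hq1, hq2⟩ := Finset.mem_filter.1 (Finset.mem_coe.1 hq)
    refine ⟨(Finset.mem_filter.1 hq1).2, ?_⟩
    rw [Metric.mem_ball, dist_eq_norm]
    refine (norm_le_abs_add_abs _).trans_lt ?_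
    simp only [PiLp.sub_apply, latPt_zero, latPt_one]
    have a1 : |q.1 - p.1| ≤ (k : ℤ) := abs_le.2 (by unfold chebDist at hq2; constructor <;> omega)
    have a2 : |q.2 - p.2| ≤ (k : ℤ) := abs_le.2 (by unfold chebDist at hq2; constructor <;> omega)
    have b1 : |(q.1 : ℝ) - p.1| ≤ k := by exact_mod_cast a1
    have b2 : |(q.2 : ℝ) - p.2| ≤ k := by exact_mod_cast a2
    linarith
  have h1 : (t.card : ENNReal) ≤ ENNReal.ofReal (C * (2 * (k + 1))) := by
    refine le_trans ?_ (hcount (latPt p) (2 * (k + 1)) (by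
      have : (0 : ℝ) ≤ k := Nat.cast_nonneg k
      linarith))
    have h2 : (t.card : ENat) ≤ (A ∩ Metric.ball (latPt p) (2 * (k + 1))).encard := by
      rw [← Set.encard_coe_eq_coe_finsetCard, ← latPt_injective.encard_image]
      exact encard_le_encard hsub
    exact_mod_cast ENat.toENNReal_le.2 h2
  rw [← ENNReal.ofReal_natCast, ENNReal.ofReal_le_ofReal_iff (by positivity)] at h1
  linarith

theorem theorem3 (A : Set Plane) (hA : A ⊆ intLattice) (C : ℝ) (hC : 0 < C)
    (hcount : ∀ x : Plane, ∀ R : ℝ, 1 < R →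
      ((A ∩ Metric.ball x R).encard : ENNReal) ≤ ENNReal.ofReal (C * R))
    (χ : ℝ → Plane → ℝ) (hχ : IsCutoffFamily χ) :
    renormalizedEnergy χ 1 (intLattice \ A) < ⊤ := by
  classical
  obtain ⟨C₀, hχ⟩ := hχ
  set D := 2 * Real.pi * (1 + C₀) * (289 * 11 ^ 2 + 4608 * (32 * (2 * C) ^ 2 * 11 * 6)) with hD
  have hle : energy χ (intLattice \ A) (totalField (latPt ⁻¹' A)) ≤ ((D / Real.pi : ℝ) : EReal) := by
    refine limsup_le_of_le (h := ?_)
    filter_upwards [eventually_gt_atTop 1] with R hR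
    obtain ⟨hs, hnn, hd, h1, h0⟩ := hχ R hR
    have hpos : 0 < Real.pi * R ^ 2 := by positivity
    have h := cutoffEnergy_totalField_le (by positivity : 0 ≤ 2 * C) rfl
      (fun m k p => card_filter_chebDist_le_of_encard hC.le hcount (latBox m) k p)
      hR hs hnn hd h1 h0
    refine (EReal.div_le_div_right_of_nonneg (EReal.coe_nonneg.2 hpos.le) h).trans (le_of_eq ?_)
    rw [← EReal.coe_div]
    congr 1
    have : R ≠ 0 := by positivity
    rw [hD]
    field_simp
  exact (iInf₂_le_of_le _ (totalField_mem_admissibleFields A) hle).trans_lt (EReal.coe_lt_top _)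

end
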